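/- Let $0<s<1$. For a function $v:\mathbb R\to\mathbb R$ let $$(-\partial_{xx})^s v(x)=C_{1,s}\ \mathrm{P.V.}\!\int_{\mathbb R}\frac{v(x)-v(y)}{|x-y|^{1+2s}}\,dy ,$$ where the constant $C_{1,s}=\big(\int_{\mathbb R}\frac{1-\cos z}{|z|^{1+2s}}\,dz\big)^{-1}$ is the one for which the operator has symbol $|\xi|^{2s}$. A *layer solution* of $(-\partial_{xx})^s v=f(v)$ in $\mathbb R$ is a bounded differentiable solution $v$ with $v'>0$ in $\mathbb R$ and $\lim_{x\to\pm\infty}v(x)=\pm1$. Let $$p_s(t,x)=\frac1\pi\int_0^\infty\cos(xr)\,e^{-tr^{2s}}\,dr\qquad(t>0,\ x\in\mathbb R).$$ Then $p_s$ is a fundamental solution of $\partial_t w+(-\partial_{xx})^s w=0$: it solves this equation for $t>0$, $x\in\mathbb R$, $p_s(t,\cdot)$ is integrable for each $t>0$, and $\int_{\mathbb R} p_s(t,x)\varphi(x)\,dx\to\varphi(0)$ as $t\downarrow0$ for every bounded continuous $\varphi$. For every $t>0$, the function $$v^t_s(x):=-1+2\int_{-\infty}^x p_s(t,y)\,dy$$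 is of class $C^\infty(\mathbb R)$ and satisfies, for all $x\in\mathbb R$ (for all $x\neq 0$ in the last equality), $$v^t_s(x)=2\int_0^x p_s(t,y)\,dy=\frac2\pi\int_0^\infty\frac{\sin(xr)}{r}\,e^{-tr^{2s}}\,dr=\operatorname{sign}(x)\,\frac2\pi\int_0^\infty\frac{\sin z}{z}\,e^{-t(z/|x|)^{2s}}\,dz .$$ There is a function $f^t_s\in C^1([-1,1])$, odd and twice differentiable in $[-1,1]$ (with one-sided derivatives at $\pm1$), such that $v^t_s$ is the layer solution, unique up to translations, of $(-\partial_{xx})^s v=f^t_s(v)$ in $\mathbb R$, and $$f^t_s(0)=f^t_s(1)=0,\qquad f^t_s>0\ \text{ in }(0,1),\qquad (f^t_s)'(\pm1)=-\frac1t,$$ $$(f^t_s)''(1)=-\frac{\pi}{t}\,\frac{\cos(\pi s)}{\sin(\pi s)}\,\frac{\Gamma(4s)}{(\Gamma(2s))^2}\ \begin{cases}<0&\text{if }0<s<1/2,\\ =0&\text{if }s=1/2,\\ >0&\text{if }1/2<s<1.\end{cases}$$ Moreover, the following limits exist and have the stated values: $$\lim_{|x|\to\infty}|x|^{1+2s}(\partial_x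 v^t_s)(x)=t\,\frac{4s}{\pi}\sin(\pi s)\,\Gamma(2s)>0,$$ $$\lim_{x\to\pm\infty}|x|^{2s}\,|v^t_s(x)\mp1|=t\,\frac{2}{\pi}\sin(\pi s)\,\Gamma(2s)>0 .$$ -/

import Mathlib

open Real Set Filter Topology MeasureTheory
open scoped ContDiff BoundedContinuousFunction

noncomputable section

/-- The normalizing constant `C_{1,s}` of the one-dimensional fractional Laplacian. Applying
`C · P.V. ∫ (v x - v y) / |x - y| ^ (1 + 2s) dy` to `v x = exp (i ξ x)` multiplies it by
`C · (∫ (1 - cos z) / |z| ^ (1 + 2s) dz) · |ξ| ^ (2s)`, so this is the constant for which the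
symbol of the operator is `|ξ| ^ (2s)`. -/
def fracLapConst (s : ℝ) : ℝ :=
  (∫ z : ℝ, (1 - Real.cos z) / |z| ^ (1 + 2 * s))⁻¹

/-- `HasFracLap s v x L`: the fractional Laplacian `(-∂_xx)^s v (x)` exists, as the Cauchy
principal value of the singular integral, and equals `L`. -/
def HasFracLap (s : ℝ) (v : ℝ → ℝ) (x L : ℝ) : Prop :=
  (∀ ε : ℝ, 0 < ε →
    IntegrableOn (fun y : ℝ => (v x - v y) / |x - y| ^ (1 + 2 * s)) {y : ℝ | ε < |x - y|}) ∧
  Tendsto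
    (fun ε : ℝ =>
      fracLapConst s * ∫ y in {y : ℝ | ε < |x - y|}, (v x - v y) / |x - y| ^ (1 + 2 * s))
    (𝓝[>] 0) (𝓝 L)

/-- `v` is a layer solution of `(-∂_xx)^s v = f(v)` in `ℝ`: a bounded solution with `v' > 0`
and limits `±1` at `±∞`. (Such a `v` takes its values in `(-1, 1)`, so only the
restriction of `f` to `[-1, 1]` matters.) -/
structure IsLayerSolution (s : ℝ) (f v : ℝ → ℝ) : Prop where
  bounded : ∃ M : ℝ, ∀ x, |v x| ≤ M
  equation : ∀ x, HasFracLap s v x (f (v x))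
  differentiable : Differentiable ℝ v
  deriv_pos : ∀ x, 0 < deriv v x
  tendsto_atTop : Tendsto v atTop (𝓝 1)
  tendsto_atBot : Tendsto v atBot (𝓝 (-1))

/-- `p = p(t, x)` is a fundamental solution of `∂_t w + (-∂_xx)^s w = 0` for `t > 0`, `x ∈ ℝ`:
it solves the equation, and `p(t, ·) dx` tends weakly to the Dirac mass at `0` as `t ↓ 0`. -/
structure IsFundamentalSolution (s : ℝ) (p : ℝ → ℝ → ℝ) : Prop where
  integrable : ∀ t : ℝ, 0 < t → Integrable (p t)
  equation : ∀ t : ℝ, 0 < t → ∀ x : ℝ, ∃ L : ℝ,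
    HasFracLap s (p t) x L ∧ HasDerivAt (fun τ : ℝ => p τ x) (-L) t
  initial : ∀ φ : ℝ →ᵇ ℝ, Tendsto (fun t : ℝ => ∫ x, p t x * φ x) (𝓝[>] 0) (𝓝 (φ 0))

/-- The fractional heat kernel `p_s(t, x)`, the inverse Fourier transform of
`ξ ↦ exp (-t |ξ| ^ (2s))`. -/
def fracHeatKernel (s t x : ℝ) : ℝ :=
  1 / π * ∫ r in Ioi (0 : ℝ), Real.cos (x * r) * Real.exp (-(t * r ^ (2 * s)))

/-- The explicit layer `v^t_s`. -/
def explicitLayer (s t x : ℝ) : ℝ :=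
  -1 + 2 * ∫ y in Iic x, fracHeatKernel s t y

end

/-!
# The explicit layers of the fractional Laplacian

Everything is read off the Fourier representation of the heat kernel
`p(t, x) = (1/π) ∫₀^∞ cos (x r) exp (-t r ^ (2s)) dr` and of its primitive, half of the layer `v`.

*The equation.* The fractional Laplacian acts on superpositions of `cos (x r)` or `sin (x r)` as
multiplication by `r ^ (2s)` (`hasFracLap_of_superposition`). For the kernel this yields the heat
equation. For the layer, an integration by parts turns the resulting sine integral into
`x p(t, x) / (s t) = x v'(x) / (2 s t)`, an explicit function of `x`; since `v` is a diffeomorphism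
onto `(-1, 1)`, this is `f (v x)` with `f` odd and positive on `(0, 1)`. Moreover
`f' (v x) = q / p`, where `q = -∂_t p` is the flux `fracHeatFlux`.

*Positivity of `p`.* The function `exp (-t |ξ| ^ (2s))` is the limit of the characteristic functions
of normalized sums of independent Pareto variables (`exists_tendsto_charFun_stable`), so `p ≥ 0`. At
a zero of `p` the time derivative would vanish, whereas the strong maximum principle
`HasFracLap.neg_of_isMin` makes the fractional Laplacian negative there; hence `p > 0`.

*Behaviour at infinity.* Rotating the ray of integration to the argument `π / 4`, where `exp (i z)`
decays exponentially and `z ^ (2s)` still has positive real part, allows one to expand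
`exp (-t (z / x) ^ (2s))` in powers of `x ^ (-2s)` under the integral. The constant term is purely
imaginary. The next ones give the leading behaviour of `p` and that of `p + t q`, in which the terms
of order `x ^ (-1 - 2s)` cancel (`tendsto_rpow_mul_fracHeatKernel`,
`tendsto_rpow_mul_fracHeatKernel_add_flux`). Together with L'Hôpital's rule for `1 - v` they yield
`f'(1)` and `f''(1)`: the difference quotients at `1` of `f` and of `f'`, taken along
`u = v x`, are `x p / (s t (v - 1))` and `(p + t q) / (t p (v - 1))`.

*Uniqueness.* As `f' (±1) = -1 / t < 0`, `f` is strictly decreasing near `±1`, and the sliding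
method applies (`IsLayerSolution.exists_eq_comp_add_const`).
-/

/-! ### The singular kernel and the normalizing constant -/

lemma setOf_lt_abs_sub (x ε : ℝ) :
    {y : ℝ | ε < |x - y|} = Iio (x - ε) ∪ Ioi (x + ε) := by
  ext y
  simp only [mem_ofPred_eq, mem_union, mem_Iio, mem_Ioi, lt_abs]
  constructor
  · rintro (h | h)
    · left; linarith
    · right; linarith
  · rintro (h | h)
    · left; linarith
    · right; linarith

lemma integrableOn_lt_abs_sub_iff {F : ℝ → ℝ} {x ε : ℝ} :
    IntegrableOn F {y : ℝ | ε < |x - y|} ↔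
      IntegrableOn (fun z => F (x + z)) (Ioi ε) ∧ IntegrableOn (fun z => F (x - z)) (Ioi ε) := by
  have e1 : Ioi ε = (fun z => x + z) ⁻¹' Ioi (x + ε) := by ext z; simp
  have e2 : Ioi ε = (fun z => x - z) ⁻¹' Iio (x - ε) := by ext z; simp
  rw [setOf_lt_abs_sub, integrableOn_union, and_comm]
  refine and_congr ?_ ?_
  · rw [e1]
    exact ((measurePreserving_add_left volume x).integrableOn_comp_preimage
      (MeasurableEquiv.addLeft x).measurableEmbedding).symm
  · rw [e2]
    exact ((Measure.measurePreserving_sub_left volume x).integrableOn_comp_preimage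
      (MeasurableEquiv.subLeft x).measurableEmbedding).symm

lemma setIntegral_lt_abs_sub {F : ℝ → ℝ} {x ε : ℝ} (hε : 0 < ε)
    (hF : IntegrableOn F {y : ℝ | ε < |x - y|}) :
    ∫ y in {y : ℝ | ε < |x - y|}, F y = ∫ z in Ioi ε, (F (x + z) + F (x - z)) := by
  have h2 := (integrableOn_lt_abs_sub_iff).1 hF
  rw [integral_add h2.1 h2.2]
  have e1 : Ioi ε = (fun z => x + z) ⁻¹' Ioi (x + ε) := by ext z; simp
  have e2 : Ioi ε = (fun z => x - z) ⁻¹' Iio (x - ε) := by ext z; simp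
  have i1 : ∫ z in Ioi ε, F (x + z) = ∫ y in Ioi (x + ε), F y := by
    rw [e1]
    exact (measurePreserving_add_left volume x).setIntegral_preimage_emb
      (MeasurableEquiv.addLeft x).measurableEmbedding F _
  have i2 : ∫ z in Ioi ε, F (x - z) = ∫ y in Iio (x - ε), F y := by
    rw [e2]
    exact (Measure.measurePreserving_sub_left volume x).setIntegral_preimage_emb
      (MeasurableEquiv.subLeft x).measurableEmbedding F _
  rw [setOf_lt_abs_sub] at hF ⊢
  rw [setIntegral_union _ measurableSet_Ioi (hF.mono_set subset_union_left)
    (hF.mono_set subset_union_right), i1, i2, add_comm]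
  rw [Set.disjoint_left]
  intro y hy hy'
  simp only [mem_Iio, mem_Ioi] at hy hy'
  linarith

lemma integrableOn_inv_rpow_Ioi {s ε : ℝ} (hs : 0 < s) (hε : 0 < ε) :
    IntegrableOn (fun z : ℝ => (z ^ (1 + 2 * s))⁻¹) (Ioi ε) := by
  refine (integrableOn_Ioi_rpow_of_lt (a := -(1 + 2 * s)) (by linarith) hε).congr_fun ?_
    measurableSet_Ioi
  intro z hz
  exact Real.rpow_neg (hε.trans hz).le _

lemma integrableOn_inv_abs_rpow {s ε : ℝ} (x : ℝ) (hs : 0 < s) (hε : 0 < ε) :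
    IntegrableOn (fun y : ℝ => (|x - y| ^ (1 + 2 * s))⁻¹) {y : ℝ | ε < |x - y|} := by
  rw [integrableOn_lt_abs_sub_iff]
  have h := integrableOn_inv_rpow_Ioi hs hε
  constructor <;> refine h.congr_fun (fun z hz => ?_) measurableSet_Ioi <;>
  · have : 0 < z := hε.trans hz
    simp [abs_of_pos this]

lemma integrableOn_fracLap_integrand {s : ℝ} (hs : 0 < s) {v : ℝ → ℝ} (hv : Continuous v)
    {M : ℝ} (hM : ∀ x, |v x| ≤ M) (x : ℝ) {ε : ℝ} (hε : 0 < ε) :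
    IntegrableOn (fun y : ℝ => (v x - v y) / |x - y| ^ (1 + 2 * s)) {y : ℝ | ε < |x - y|} := by
  simp only [div_eq_mul_inv]
  refine Integrable.bdd_mul (c := M + M) (integrableOn_inv_abs_rpow x hs hε)
    (by fun_prop) (ae_of_all _ fun y => ?_)
  calc ‖v x - v y‖ ≤ ‖v x‖ + ‖v y‖ := norm_sub_le _ _
    _ ≤ M + M := add_le_add (hM x) (hM y)

/-- The integrand behind `C_{1,s}` is integrable: it is `O(z ^ (1 - 2s))` at the origin and
`O(z ^ (-1 - 2s))` at infinity. -/
lemma integrableOn_one_sub_cos_div {s : ℝ} (hs0 : 0 < s) (hs1 : s < 1) :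
    IntegrableOn (fun z : ℝ => (1 - Real.cos z) / z ^ (1 + 2 * s)) (Ioi 0) := by
  rw [← Ioc_union_Ioi_eq_Ioi zero_le_one]
  have hm : Measurable (fun z : ℝ => (1 - Real.cos z) / z ^ (1 + 2 * s)) := by fun_prop
  refine IntegrableOn.union ?_ ?_
  · have h1 : IntegrableOn (fun z : ℝ => z ^ (1 - 2 * s)) (Ioc 0 1) := by
      have := intervalIntegral.intervalIntegrable_rpow' (a := 0) (b := 1) (r := 1 - 2 * s)
        (by linarith)
      rwa [intervalIntegrable_iff_integrableOn_Ioc_of_le zero_le_one] at this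
    refine Integrable.mono' h1 hm.aestronglyMeasurable ?_
    refine (ae_restrict_iff' measurableSet_Ioc).2 (ae_of_all _ fun z hz => ?_)
    have hz0 : 0 < z := hz.1
    rw [Real.norm_of_nonneg (div_nonneg (by linarith [Real.cos_le_one z])
      (Real.rpow_nonneg hz0.le _)), div_le_iff₀ (Real.rpow_pos_of_pos hz0 _),
      ← Real.rpow_add hz0, show 1 - 2 * s + (1 + 2 * s) = (2 : ℕ) by push_cast; ring,
      Real.rpow_natCast]
    nlinarith [Real.one_sub_sq_div_two_le_cos (x := z), sq_nonneg z]
  · refine Integrable.mono' ((integrableOn_inv_rpow_Ioi hs0 one_pos).const_mul 2)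
      hm.aestronglyMeasurable ?_
    refine (ae_restrict_iff' measurableSet_Ioi).2 (ae_of_all _ fun z hz => ?_)
    have hz0 : 0 < z := zero_lt_one.trans hz
    rw [Real.norm_of_nonneg (div_nonneg (by linarith [Real.cos_le_one z])
      (Real.rpow_nonneg hz0.le _)), div_eq_mul_inv]
    exact mul_le_mul_of_nonneg_right (by linarith [Real.neg_one_le_cos z])
      (inv_nonneg.2 (Real.rpow_nonneg hz0.le _))

/-- Half of the normalizing integral: `∫₀^∞ (1 - cos z) / z ^ (1 + 2s) dz`. -/
noncomputable def oneSubCosIntegral (s : ℝ) : ℝ :=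
  ∫ z in Ioi (0 : ℝ), (1 - Real.cos z) / z ^ (1 + 2 * s)

lemma oneSubCosIntegral_pos {s : ℝ} (hs0 : 0 < s) (hs1 : s < 1) : 0 < oneSubCosIntegral s := by
  refine (setIntegral_pos_iff_support_of_nonneg_ae ?_
    (integrableOn_one_sub_cos_div hs0 hs1)).2 ?_
  · refine (ae_restrict_iff' measurableSet_Ioi).2 (ae_of_all _ fun z hz => ?_)
    exact div_nonneg (by linarith [Real.cos_le_one z]) (Real.rpow_nonneg (le_of_lt hz) _)
  · refine lt_of_lt_of_le (b := volume (Ioo 0 π)) (by simp [Real.pi_pos]) (measure_mono ?_)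
    intro z hz
    refine ⟨?_, hz.1⟩
    have : Real.cos z < 1 := by
      rw [← Real.cos_zero]
      exact Real.cos_lt_cos_of_nonneg_of_le_pi le_rfl hz.2.le hz.1
    exact div_ne_zero (by linarith) (Real.rpow_pos_of_pos hz.1 _).ne'

lemma fracLapConst_eq (s : ℝ) : fracLapConst s = (2 * oneSubCosIntegral s)⁻¹ := by
  unfold fracLapConst oneSubCosIntegral
  congr 1
  have := integral_comp_abs (f := fun z : ℝ => (1 - Real.cos z) / z ^ (1 + 2 * s))
  simpa only [Real.cos_abs] using this

lemma fracLapConst_pos {s : ℝ} (hs0 : 0 < s) (hs1 : s < 1) : 0 < fracLapConst s := by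
  rw [fracLapConst_eq]
  have := oneSubCosIntegral_pos hs0 hs1
  positivity

lemma tendsto_setIntegral_one_sub_cos_Ioi {s : ℝ} (hs0 : 0 < s) (hs1 : s < 1) :
    Tendsto (fun b : ℝ => ∫ z in Ioi b, (1 - Real.cos z) / z ^ (1 + 2 * s)) (𝓝[>] 0)
      (𝓝 (oneSubCosIntegral s)) := by
  have hA0 := integrableOn_one_sub_cos_div hs0 hs1
  have h1 : ∀ b : ℝ, 0 < b → ∫ z in Ioi b, (1 - Real.cos z) / z ^ (1 + 2 * s) =
      oneSubCosIntegral s - ∫ z in (0 : ℝ)..b, (1 - Real.cos z) / z ^ (1 + 2 * s) := by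
    intro b hb
    have := intervalIntegral.integral_interval_add_Ioi' (a := 0) (b := b)
      (f := fun z : ℝ => (1 - Real.cos z) / z ^ (1 + 2 * s)) (μ := volume) ?_
      (hA0.mono_set (Ioi_subset_Ioi hb.le))
    · unfold oneSubCosIntegral
      linarith
    · rw [intervalIntegrable_iff_integrableOn_Ioc_of_le hb.le]
      exact hA0.mono_set Ioc_subset_Ioi_self
  have hc : ContinuousWithinAt
      (fun b => ∫ z in (0 : ℝ)..b, (1 - Real.cos z) / z ^ (1 + 2 * s)) (Icc 0 1) 0 := by
    refine intervalIntegral.continuousWithinAt_primitive (by simp) ?_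
    rw [min_self, max_eq_right zero_le_one,
      intervalIntegrable_iff_integrableOn_Ioc_of_le zero_le_one]
    exact hA0.mono_set Ioc_subset_Ioi_self
  have h2 := (tendsto_const_nhds (x := oneSubCosIntegral s)).sub
    (hc.tendsto.mono_left (nhdsWithin_mono 0 Ioc_subset_Icc_self))
  rw [nhdsWithin_Ioc_eq_nhdsGT one_pos, intervalIntegral.integral_same, sub_zero] at h2
  refine h2.congr' ?_
  filter_upwards [self_mem_nhdsWithin] with b hb
  exact (h1 b hb).symm

/-! ### Elementary properties of the fractional Laplacian -/

lemma HasFracLap.comp_add_const {s : ℝ} {v : ℝ → ℝ} {x b L : ℝ}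
    (h : HasFracLap s v (x + b) L) : HasFracLap s (fun y => v (y + b)) x L := by
  have hset : ∀ ε : ℝ, {y : ℝ | ε < |x - y|} = (fun y => y + b) ⁻¹' {y : ℝ | ε < |x + b - y|} := by
    intro ε
    ext y
    simp
  have hf : (fun y : ℝ => (v (x + b) - v (y + b)) / |x - y| ^ (1 + 2 * s)) =
      (fun y : ℝ => (v (x + b) - v y) / |x + b - y| ^ (1 + 2 * s)) ∘ (fun y => y + b) := by
    funext y
    simp
  have hmp := measurePreserving_add_right (volume : Measure ℝ) b
  have hme := (MeasurableEquiv.addRight b).measurableEmbedding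
  refine ⟨fun ε hε => ?_, ?_⟩
  · show IntegrableOn (fun y : ℝ => (v (x + b) - v (y + b)) / |x - y| ^ (1 + 2 * s)) _
    rw [hset, hf]
    exact (hmp.integrableOn_comp_preimage hme).2 (h.1 ε hε)
  · refine h.2.congr fun ε => ?_
    congr 1
    rw [hset]
    rw [← hmp.setIntegral_preimage_emb hme]
    simp

lemma HasFracLap.sub {s : ℝ} {v w : ℝ → ℝ} {x L L' : ℝ} (hv : HasFracLap s v x L)
    (hw : HasFracLap s w x L') : HasFracLap s (fun y => v y - w y) x (L - L') := by
  have e : (fun y : ℝ => (v x - w x - (v y - w y)) / |x - y| ^ (1 + 2 * s)) =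
      fun y => (v x - v y) / |x - y| ^ (1 + 2 * s) - (w x - w y) / |x - y| ^ (1 + 2 * s) := by
    funext y
    ring
  refine ⟨fun ε hε => ?_, ?_⟩
  · rw [e]
    exact (hv.1 ε hε).sub (hw.1 ε hε)
  · refine (hv.2.sub hw.2).congr' ?_
    filter_upwards [self_mem_nhdsWithin] with ε hε
    rw [e, integral_sub (hv.1 ε hε) (hw.1 ε hε), mul_sub]

/-- At a global minimum the truncated integrals are nonpositive and decrease as the truncation
is removed, so the principal value lies below each of them. -/
lemma HasFracLap.le_of_isMin {s : ℝ} (hs0 : 0 < s) (hs1 : s < 1) {v : ℝ → ℝ} {x L : ℝ}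
    (h : HasFracLap s v x L) (hmin : ∀ y, v x ≤ v y) {ε : ℝ} (hε : 0 < ε) :
    L ≤ fracLapConst s * ∫ y in {y : ℝ | ε < |x - y|}, (v x - v y) / |x - y| ^ (1 + 2 * s) := by
  refine le_of_tendsto h.2 ?_
  filter_upwards [Ioo_mem_nhdsGT hε] with δ hδ
  refine mul_le_mul_of_nonneg_left ?_ (fracLapConst_pos hs0 hs1).le
  have hsub : {y : ℝ | ε < |x - y|} ⊆ {y : ℝ | δ < |x - y|} := fun y hy => hδ.2.trans hy
  have h1 := setIntegral_mono_set (μ := volume)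
    (f := fun y => -((v x - v y) / |x - y| ^ (1 + 2 * s))) (h.1 δ hδ.1).neg
    (ae_of_all _ fun y => ?_) (LE.le.eventuallyLE hsub)
  · rw [integral_neg, integral_neg] at h1
    linarith
  · show 0 ≤ -((v x - v y) / |x - y| ^ (1 + 2 * s))
    rw [← neg_div]
    exact div_nonneg (by linarith [hmin y]) (Real.rpow_nonneg (abs_nonneg _) _)

/-- Strong maximum principle at a point: at a global minimum of a continuous function the
fractional Laplacian is strictly negative unless the function is constant. -/
lemma HasFracLap.neg_of_isMin {s : ℝ} (hs0 : 0 < s) (hs1 : s < 1) {v : ℝ → ℝ} {x L : ℝ}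
    (h : HasFracLap s v x L) (hv : Continuous v) (hmin : ∀ y, v x ≤ v y)
    {y₀ : ℝ} (hy₀ : v x < v y₀) : L < 0 := by
  have hne : x ≠ y₀ := fun h => by rw [h] at hy₀; exact lt_irrefl _ hy₀
  set ε := |x - y₀| / 2 with hεdef
  have hpos : 0 < |x - y₀| := abs_pos.2 (sub_ne_zero.2 hne)
  have hε : 0 < ε := by positivity
  refine lt_of_le_of_lt (h.le_of_isMin hs0 hs1 hmin hε) ?_
  refine mul_neg_of_pos_of_neg (fracLapConst_pos hs0 hs1) ?_
  rw [← neg_pos, ← integral_neg]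
  refine (setIntegral_pos_iff_support_of_nonneg_ae ?_ (h.1 ε hε).neg).2 ?_
  · refine ae_of_all _ fun y => ?_
    show 0 ≤ -((v x - v y) / |x - y| ^ (1 + 2 * s))
    rw [← neg_div]
    exact div_nonneg (by linarith [hmin y]) (Real.rpow_nonneg (abs_nonneg _) _)
  · have hopen : IsOpen ({y : ℝ | v x < v y} ∩ {y : ℝ | ε < |x - y|}) :=
      (isOpen_lt continuous_const hv).inter (isOpen_lt continuous_const (by fun_prop))
    refine lt_of_lt_of_le (hopen.measure_pos volume ⟨y₀, hy₀, ?_⟩) (measure_mono ?_)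
    · show |x - y₀| / 2 < |x - y₀|
      linarith
    · rintro y ⟨hy1, hy2⟩
      refine ⟨?_, hy2⟩
      have : 0 < |x - y| := hε.trans hy2
      have hy1' : v x < v y := hy1
      exact neg_ne_zero.2 (div_ne_zero (by linarith) (Real.rpow_pos_of_pos this _).ne')

/-! ### The fractional Laplacian as a Fourier multiplier -/

/-- The homogeneity behind the symbol: truncating at `ε` and rescaling the frequency to `1` moves the
truncation to `ε r` and produces the factor `r ^ (2s)`. -/
lemma integral_one_sub_cos_mul {s ε r : ℝ} (hε : 0 ≤ ε) (hr : 0 < r) :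
    ∫ z in Ioi ε, (1 - Real.cos (z * r)) / z ^ (1 + 2 * s) =
      r ^ (2 * s) * ∫ z in Ioi (ε * r), (1 - Real.cos z) / z ^ (1 + 2 * s) := by
  have h := integral_comp_mul_right_Ioi
    (fun z : ℝ => (1 - Real.cos z) / z ^ (1 + 2 * s)) ε hr
  have e : ∀ z ∈ Ioi ε, (1 - Real.cos (z * r)) / z ^ (1 + 2 * s) =
      r ^ (1 + 2 * s) * ((1 - Real.cos (z * r)) / (z * r) ^ (1 + 2 * s)) := by
    intro z hz
    have hz0 : 0 < z := lt_of_le_of_lt hε hz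
    rw [Real.mul_rpow hz0.le hr.le]
    have := (Real.rpow_pos_of_pos hr (1 + 2 * s)).ne'
    have := (Real.rpow_pos_of_pos hz0 (1 + 2 * s)).ne'
    field_simp
  rw [setIntegral_congr_fun measurableSet_Ioi e, integral_const_mul, h, smul_eq_mul, ← mul_assoc]
  congr 1
  rw [Real.rpow_add hr, Real.rpow_one]
  field_simp

/-- The fractional Laplacian acts on superpositions of `k(·, r)`, a solution of the cosine
addition law with frequency `r` (in practice `cos (x r)` or `sin (x r)`), by multiplying the
amplitude `m r` by `r ^ (2s)`. Only `k m` and `r ^ (2s) m` need to be integrable, not `m`. -/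
lemma hasFracLap_of_superposition {s : ℝ} (hs0 : 0 < s) (hs1 : s < 1) {k : ℝ → ℝ → ℝ}
    {m u : ℝ → ℝ} {M : ℝ} (hk : ∀ x z r, k (x + z) r + k (x - z) r = 2 * (k x r * Real.cos (z * r)))
    (hk1 : ∀ x r, |k x r| ≤ 1) (hkm : ∀ x, Measurable (k x))
    (hint : ∀ x, IntegrableOn (fun r => k x r * m r) (Ioi 0))
    (hint2 : IntegrableOn (fun r => r ^ (2 * s) * m r) (Ioi 0))
    (hu : ∀ x, u x = ∫ r in Ioi (0 : ℝ), k x r * m r) (huc : Continuous u)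
    (hub : ∀ x, |u x| ≤ M) (x : ℝ) :
    HasFracLap s u x (∫ r in Ioi (0 : ℝ), k x r * (r ^ (2 * s) * m r)) := by
  refine ⟨fun ε hε => integrableOn_fracLap_integrand hs0 huc hub x hε, ?_⟩
  -- the inner integral over the truncated region, as a function of the frequency
  let A : ℝ → ℝ → ℝ := fun ε r => ∫ z in Ioi (ε * r), (1 - Real.cos z) / z ^ (1 + 2 * s)
  have hA0 := integrableOn_one_sub_cos_div hs0 hs1
  have hnn : ∀ z ∈ Ioi (0 : ℝ), 0 ≤ (1 - Real.cos z) / z ^ (1 + 2 * s) := fun z hz =>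
    div_nonneg (by linarith [Real.cos_le_one z]) (Real.rpow_nonneg (le_of_lt hz) _)
  have hAle : ∀ ε r : ℝ, 0 ≤ ε → 0 < r → |A ε r| ≤ oneSubCosIntegral s := by
    intro ε r hε hr
    have hsub : Ioi (ε * r) ⊆ Ioi 0 := Ioi_subset_Ioi (by positivity)
    rw [abs_of_nonneg (setIntegral_nonneg measurableSet_Ioi fun z hz => hnn z (hsub hz))]
    exact setIntegral_mono_set hA0 ((ae_restrict_iff' measurableSet_Ioi).2 (ae_of_all _ hnn))
      (LE.le.eventuallyLE hsub)
  have hAlim : ∀ r : ℝ, 0 < r → Tendsto (fun ε => A ε r) (𝓝[>] 0) (𝓝 (oneSubCosIntegral s)) := by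
    intro r hr
    refine (tendsto_setIntegral_one_sub_cos_Ioi hs0 hs1).comp
      (tendsto_nhdsWithin_iff.2 ⟨?_, ?_⟩)
    · have : Tendsto (fun ε : ℝ => ε * r) (𝓝 0) (𝓝 (0 * r)) :=
        (continuous_id.mul continuous_const).tendsto 0
      rw [zero_mul] at this
      exact this.mono_left nhdsWithin_le_nhds
    · filter_upwards [self_mem_nhdsWithin] with ε hε
      exact mul_pos hε hr
  -- the truncated operator in Fourier variables
  have key : ∀ ε : ℝ, 0 < ε →
      ∫ y in {y : ℝ | ε < |x - y|}, (u x - u y) / |x - y| ^ (1 + 2 * s) =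
        ∫ r in Ioi (0 : ℝ), 2 * (k x r * (r ^ (2 * s) * m r)) * A ε r := by
    intro ε hε
    rw [setIntegral_lt_abs_sub hε (integrableOn_fracLap_integrand hs0 huc hub x hε)]
    have e1 : ∀ z ∈ Ioi ε, (u x - u (x + z)) / |x - (x + z)| ^ (1 + 2 * s) +
        (u x - u (x - z)) / |x - (x - z)| ^ (1 + 2 * s) =
        ∫ r in Ioi (0 : ℝ), 2 * (k x r * m r) * ((1 - Real.cos (z * r)) / z ^ (1 + 2 * s)) := by
      intro z hz
      have hz0 : 0 < z := hε.trans hz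
      have : ∀ r, 2 * (k x r * m r) * ((1 - Real.cos (z * r)) / z ^ (1 + 2 * s)) =
          (2 * (k x r * m r) - k (x + z) r * m r - k (x - z) r * m r) * (z ^ (1 + 2 * s))⁻¹ := by
        intro r
        have := hk x z r
        rw [show (2 * (k x r * m r) - k (x + z) r * m r - k (x - z) r * m r)
          = 2 * (k x r * m r) - (k (x + z) r + k (x - z) r) * m r by ring, this]
        ring
      simp_rw [this]
      have i1 : Integrable (fun r => 2 * (k x r * m r) - k (x + z) r * m r)
        (volume.restrict (Ioi 0)) := ((hint x).const_mul 2).sub (hint _)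
      rw [integral_mul_const, integral_sub i1 (hint _),
        integral_sub ((hint x).const_mul 2) (hint _), integral_const_mul, ← hu, ← hu, ← hu,
        show x - (x + z) = -z by ring, show x - (x - z) = z by ring, abs_neg, abs_of_pos hz0]
      ring
    rw [setIntegral_congr_fun measurableSet_Ioi e1, integral_integral_swap]
    · refine setIntegral_congr_fun measurableSet_Ioi fun r hr => ?_
      rw [integral_const_mul, integral_one_sub_cos_mul hε.le hr]
      ring
    · have hg : Integrable (fun p : ℝ × ℝ => (p.1 ^ (1 + 2 * s))⁻¹ * (2 * (k x p.2 * m p.2)))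
          ((volume.restrict (Ioi ε)).prod (volume.restrict (Ioi 0))) :=
        Integrable.mul_prod (integrableOn_inv_rpow_Ioi hs0 hε) ((hint x).const_mul 2)
      have := Integrable.bdd_mul (c := 2) (f := fun p : ℝ × ℝ => 1 - Real.cos (p.1 * p.2)) hg
        (by fun_prop) (ae_of_all _ fun p => ?_)
      · refine this.congr (ae_of_all _ fun p => ?_)
        simp only [Function.uncurry]
        ring
      · rw [Real.norm_eq_abs, abs_le]
        constructor <;> linarith [Real.cos_le_one (p.1 * p.2), Real.neg_one_le_cos (p.1 * p.2)]
  -- dominated convergence as the truncation is removed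
  have hkm2 : IntegrableOn (fun r => k x r * (r ^ (2 * s) * m r)) (Ioi 0) :=
    Integrable.bdd_mul (c := 1) hint2 (hkm x).aestronglyMeasurable (ae_of_all _ fun r => hk1 x r)
  have hmeas : ∀ ε : ℝ, 0 < ε → AEStronglyMeasurable (A ε) (volume.restrict (Ioi 0)) := by
    intro ε hε
    refine (aemeasurable_restrict_of_antitoneOn measurableSet_Ioi ?_).aestronglyMeasurable
    intro r hr r' _ hrr
    refine setIntegral_mono_set (hA0.mono_set (Ioi_subset_Ioi (mul_pos hε hr).le)) ?_
      (LE.le.eventuallyLE (Ioi_subset_Ioi (mul_le_mul_of_nonneg_left hrr hε.le)))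
    exact (ae_restrict_iff' measurableSet_Ioi).2 (ae_of_all _ fun z hz =>
      hnn z ((mul_pos hε hr).trans hz))
  have hlim : Tendsto (fun ε => ∫ r in Ioi (0 : ℝ), 2 * (k x r * (r ^ (2 * s) * m r)) * A ε r)
      (𝓝[>] 0)
      (𝓝 (∫ r in Ioi (0 : ℝ), 2 * (k x r * (r ^ (2 * s) * m r)) * oneSubCosIntegral s)) := by
    refine tendsto_integral_filter_of_dominated_convergence
      (fun r => ‖2 * (k x r * (r ^ (2 * s) * m r))‖ * oneSubCosIntegral s) ?_ ?_ ?_ ?_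
    · filter_upwards [self_mem_nhdsWithin] with ε hε
      exact ((hkm2.const_mul 2).aestronglyMeasurable).mul (hmeas ε hε)
    · filter_upwards [self_mem_nhdsWithin] with ε hε
      refine (ae_restrict_iff' measurableSet_Ioi).2 (ae_of_all _ fun r hr => ?_)
      rw [norm_mul]
      exact mul_le_mul_of_nonneg_left (hAle ε r (le_of_lt hε) hr) (norm_nonneg _)
    · exact ((hkm2.const_mul 2).norm).mul_const _
    · refine (ae_restrict_iff' measurableSet_Ioi).2 (ae_of_all _ fun r hr => ?_)
      exact (hAlim r hr).const_mul _
  have hfin := hlim.const_mul (fracLapConst s)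
  have hval : fracLapConst s *
      ∫ r in Ioi (0 : ℝ), 2 * (k x r * (r ^ (2 * s) * m r)) * oneSubCosIntegral s =
      ∫ r in Ioi (0 : ℝ), k x r * (r ^ (2 * s) * m r) := by
    rw [integral_mul_const, integral_const_mul, fracLapConst_eq]
    have := (oneSubCosIntegral_pos hs0 hs1).ne'
    field_simp
  rw [hval] at hfin
  refine hfin.congr' ?_
  filter_upwards [self_mem_nhdsWithin] with ε hε
  rw [key ε hε]

/-! ### Sine and cosine integrals of stretched exponentials -/

lemma integrableOn_rpow_mul_stretchedExp {s t a : ℝ} (hs0 : 0 < s) (ht : 0 < t) (ha : -1 < a) :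
    IntegrableOn (fun r : ℝ => r ^ a * Real.exp (-(t * r ^ (2 * s)))) (Ioi 0) := by
  have := integrableOn_rpow_mul_exp_neg_mul_rpow (s := a) (p := 2 * s) ha (by linarith) ht
  simpa only [neg_mul] using this

lemma integrableOn_stretchedExp {s t : ℝ} (hs0 : 0 < s) (ht : 0 < t) :
    IntegrableOn (fun r : ℝ => Real.exp (-(t * r ^ (2 * s)))) (Ioi 0) := by
  simpa using integrableOn_rpow_mul_stretchedExp (a := 0) hs0 ht (by norm_num)

lemma integrableOn_cos_mul {m : ℝ → ℝ} (hm : IntegrableOn m (Ioi 0)) (x : ℝ) :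
    IntegrableOn (fun r => Real.cos (x * r) * m r) (Ioi 0) :=
  Integrable.bdd_mul (c := 1) hm (by fun_prop) (ae_of_all _ fun _ => Real.abs_cos_le_one _)

lemma integrableOn_sin_mul {m : ℝ → ℝ} (hm : IntegrableOn m (Ioi 0)) (x : ℝ) :
    IntegrableOn (fun r => Real.sin (x * r) * m r) (Ioi 0) :=
  Integrable.bdd_mul (c := 1) hm (by fun_prop) (ae_of_all _ fun _ => Real.abs_sin_le_one _)

/-- Differentiation of a sine integral; the amplitude itself need not be integrable at `0`. -/
lemma hasDerivAt_integral_sin_mul {m : ℝ → ℝ} (hm : Measurable m)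
    (hint : IntegrableOn (fun r => r * m r) (Ioi 0)) (x : ℝ) :
    HasDerivAt (fun x => ∫ r in Ioi (0 : ℝ), Real.sin (x * r) * m r)
      (∫ r in Ioi (0 : ℝ), Real.cos (x * r) * (r * m r)) x := by
  refine (hasDerivAt_integral_of_dominated_loc_of_deriv_le
    (F' := fun x r => Real.cos (x * r) * (r * m r)) (bound := fun r => ‖r * m r‖)
    univ_mem ?_ ?_ ?_ ?_ hint.norm ?_).2
  · exact Eventually.of_forall fun y => by fun_prop
  · refine Integrable.mono' (hint.norm.const_mul |x|) (by fun_prop)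
      (ae_of_all _ fun r => ?_)
    rw [Real.norm_eq_abs, Real.norm_eq_abs, abs_mul, abs_mul r, ← mul_assoc, ← abs_mul x]
    exact mul_le_mul_of_nonneg_right Real.abs_sin_le_abs (abs_nonneg _)
  · fun_prop
  · refine ae_of_all _ fun r y _ => ?_
    rw [norm_mul]
    exact mul_le_of_le_one_left (norm_nonneg _) (Real.abs_cos_le_one _)
  · refine ae_of_all _ fun r y _ => ?_
    have h1 : HasDerivAt (fun y : ℝ => y * r) r y := by
      simpa using (hasDerivAt_id y).mul_const r
    have := h1.sin.mul_const (m r)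
    convert! this using 1
    ring

/-- `∫₀^∞ cos (x r) r ^ (2s) exp (-t r ^ (2s)) dr / π`, the value of `(-∂_xx)^s p` and of
`-∂_t p` for the fractional heat kernel `p`. -/
noncomputable def fracHeatFlux (s t x : ℝ) : ℝ :=
  1 / π * ∫ r in Ioi (0 : ℝ), Real.cos (x * r) * (r ^ (2 * s) * Real.exp (-(t * r ^ (2 * s))))

/-- `∫₀^∞ (sin (x r) / r) exp (-t r ^ (2s)) dr / π`, the primitive of the fractional heat kernel
that vanishes at the origin. -/
noncomputable def fracHeatPrimitive (s t x : ℝ) : ℝ :=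
  1 / π * ∫ r in Ioi (0 : ℝ), Real.sin (x * r) * (r⁻¹ * Real.exp (-(t * r ^ (2 * s))))

section
variable {s t : ℝ}

lemma hasDerivAt_fracHeatPrimitive (hs0 : 0 < s) (ht : 0 < t) (x : ℝ) :
    HasDerivAt (fracHeatPrimitive s t) (fracHeatKernel s t x) x := by
  have e : ∀ r ∈ Ioi (0 : ℝ), r * (r⁻¹ * Real.exp (-(t * r ^ (2 * s)))) =
      Real.exp (-(t * r ^ (2 * s))) := fun r hr => mul_inv_cancel_left₀ (ne_of_gt hr) _
  have h := hasDerivAt_integral_sin_mul (m := fun r => r⁻¹ * Real.exp (-(t * r ^ (2 * s))))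
    (by fun_prop) ((integrableOn_stretchedExp hs0 ht).congr_fun (fun r hr => (e r hr).symm)
      measurableSet_Ioi) x
  convert! h.const_mul (1 / π) using 1
  unfold fracHeatKernel
  congr 1
  refine setIntegral_congr_fun measurableSet_Ioi fun r hr => ?_
  rw [e r hr]

lemma integrableOn_sin_div_mul_stretchedExp (hs0 : 0 < s) (ht : 0 < t) (x : ℝ) :
    IntegrableOn (fun r : ℝ => Real.sin (x * r) / r * Real.exp (-(t * r ^ (2 * s)))) (Ioi 0) := by
  refine Integrable.mono' ((integrableOn_stretchedExp hs0 ht).const_mul |x|) (by fun_prop) ?_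
  refine (ae_restrict_iff' measurableSet_Ioi).2 (ae_of_all _ fun r hr => ?_)
  rw [norm_mul, Real.norm_of_nonneg (Real.exp_nonneg _)]
  refine mul_le_mul_of_nonneg_right ?_ (Real.exp_nonneg _)
  rw [Real.norm_eq_abs, abs_div, div_le_iff₀ (abs_pos.2 (ne_of_gt hr)), ← abs_mul]
  exact Real.abs_sin_le_abs

lemma fracHeatPrimitive_eq (s t x : ℝ) : fracHeatPrimitive s t x =
    1 / π * ∫ r in Ioi (0 : ℝ), Real.sin (x * r) / r * Real.exp (-(t * r ^ (2 * s))) := by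
  simp only [fracHeatPrimitive, div_eq_mul_inv, mul_assoc]

lemma fracHeatPrimitive_zero (s t : ℝ) : fracHeatPrimitive s t 0 = 0 := by
  simp [fracHeatPrimitive]

lemma fracHeatKernel_neg (s t x : ℝ) : fracHeatKernel s t (-x) = fracHeatKernel s t x := by
  simp [fracHeatKernel]

lemma fracHeatFlux_neg (s t x : ℝ) : fracHeatFlux s t (-x) = fracHeatFlux s t x := by
  simp [fracHeatFlux]

lemma hasDerivAt_fracHeatKernel_time (hs0 : 0 < s) (ht : 0 < t) (x : ℝ) :
    HasDerivAt (fun τ => fracHeatKernel s τ x) (-fracHeatFlux s t x) t := by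
  have h := (hasDerivAt_integral_of_dominated_loc_of_deriv_le (μ := volume.restrict (Ioi 0))
    (F := fun τ r => Real.cos (x * r) * Real.exp (-(τ * r ^ (2 * s))))
    (F' := fun τ r => -(Real.cos (x * r) * (r ^ (2 * s) * Real.exp (-(τ * r ^ (2 * s))))))
    (bound := fun r => r ^ (2 * s) * Real.exp (-(t / 2 * r ^ (2 * s))))
    (Ioi_mem_nhds (half_lt_self ht)) ?_ ?_ ?_ ?_ ?_ ?_).2
  · have := h.const_mul (1 / π)
    rw [integral_neg, mul_neg] at this
    exact this
  · exact Eventually.of_forall fun y => by fun_prop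
  · exact integrableOn_cos_mul (integrableOn_stretchedExp hs0 ht) x
  · fun_prop
  · refine (ae_restrict_iff' measurableSet_Ioi).2 (ae_of_all _ fun r hr τ hτ => ?_)
    have hr0 : 0 ≤ r ^ (2 * s) := Real.rpow_nonneg (le_of_lt hr) _
    rw [norm_neg, norm_mul, Real.norm_of_nonneg (mul_nonneg hr0 (Real.exp_nonneg _))]
    refine (mul_le_of_le_one_left (mul_nonneg hr0 (Real.exp_nonneg _))
      (Real.abs_cos_le_one _)).trans (mul_le_mul_of_nonneg_left ?_ hr0)
    exact Real.exp_le_exp.2 (neg_le_neg (mul_le_mul_of_nonneg_right (le_of_lt hτ) hr0))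
  · exact integrableOn_rpow_mul_stretchedExp hs0 (half_pos ht) (by linarith)
  · refine ae_of_all _ fun r τ _ => ?_
    have h1 : HasDerivAt (fun τ : ℝ => -(τ * r ^ (2 * s))) (-(r ^ (2 * s))) τ := by
      simpa using ((hasDerivAt_id τ).mul_const (r ^ (2 * s))).fun_neg
    convert! h1.exp.const_mul (Real.cos (x * r)) using 1
    ring

lemma hasDerivAt_stretchedExp {r : ℝ} (hr : 0 < r) :
    HasDerivAt (fun r : ℝ => Real.exp (-(t * r ^ (2 * s))))
      (-(2 * s * t * (r ^ (2 * s - 1) * Real.exp (-(t * r ^ (2 * s)))))) r := by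
  have h1 := (((Real.hasDerivAt_rpow_const (p := 2 * s) (Or.inl hr.ne')).const_mul t).fun_neg).exp
  convert! h1 using 1
  ring

lemma tendsto_stretchedExp_atTop (hs0 : 0 < s) (ht : 0 < t) :
    Tendsto (fun r : ℝ => Real.exp (-(t * r ^ (2 * s)))) atTop (𝓝 0) :=
  Real.tendsto_exp_neg_atTop_nhds_zero.comp
    ((tendsto_rpow_atTop (by linarith)).const_mul_atTop ht)

/-- Integration by parts: `x p(t, x)` is, up to a factor, the fractional Laplacian of the
primitive of the kernel. -/
lemma mul_fracHeatKernel_eq (hs0 : 0 < s) (ht : 0 < t) (x : ℝ) :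
    x * fracHeatKernel s t x = 2 * s * t * (1 / π *
      ∫ r in Ioi (0 : ℝ), Real.sin (x * r) * (r ^ (2 * s - 1) * Real.exp (-(t * r ^ (2 * s))))) := by
  have i1 := integrableOn_cos_mul (integrableOn_stretchedExp hs0 ht) x
  have i2 := integrableOn_sin_mul
    (integrableOn_rpow_mul_stretchedExp (a := 2 * s - 1) hs0 ht (by linarith)) x
  have h := integral_Ioi_of_hasDerivAt_of_tendsto (a := 0) (m := 0)
    (f := fun r => Real.sin (x * r) * Real.exp (-(t * r ^ (2 * s))))
    (f' := fun r => x * (Real.cos (x * r) * Real.exp (-(t * r ^ (2 * s)))) -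
      2 * s * t * (Real.sin (x * r) * (r ^ (2 * s - 1) * Real.exp (-(t * r ^ (2 * s))))))
    ?_ ?_ ?_ ?_
  · rw [integral_sub (i1.const_mul _) (i2.const_mul _), integral_const_mul,
      integral_const_mul] at h
    simp only [mul_zero, Real.sin_zero, zero_mul, sub_zero] at h
    unfold fracHeatKernel
    linear_combination (1 / π) * h
  · have : Continuous fun r : ℝ => r ^ (2 * s) := Real.continuous_rpow_const (by linarith)
    exact (by fun_prop : Continuous fun r =>
      Real.sin (x * r) * Real.exp (-(t * r ^ (2 * s)))).continuousWithinAt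
  · intro r hr
    have h1 : HasDerivAt (fun r : ℝ => x * r) x r := by
      simpa using (hasDerivAt_id r).const_mul x
    convert! h1.sin.mul (hasDerivAt_stretchedExp (s := s) (t := t) hr) using 1
    ring
  · exact (i1.const_mul _).sub (i2.const_mul _)
  · refine squeeze_zero_norm (fun r => ?_) (tendsto_stretchedExp_atTop (s := s) hs0 ht)
    rw [norm_mul, Real.norm_of_nonneg (Real.exp_nonneg _)]
    exact mul_le_of_le_one_left (Real.exp_nonneg _) (Real.abs_sin_le_one _)

/-- The identity `p + x p' = 2 s t q` between the kernel, its spatial derivative and the flux `q`;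
it also expresses the self-similarity of the kernel. -/
lemma hasDerivAt_mul_fracHeatKernel (hs0 : 0 < s) (ht : 0 < t) (x : ℝ) :
    HasDerivAt (fun x => x * fracHeatKernel s t x) (2 * s * t * fracHeatFlux s t x) x := by
  have e : ∀ r ∈ Ioi (0 : ℝ), r * (r ^ (2 * s - 1) * Real.exp (-(t * r ^ (2 * s)))) =
      r ^ (2 * s) * Real.exp (-(t * r ^ (2 * s))) := by
    intro r hr
    rw [← mul_assoc, Real.rpow_sub_one (ne_of_gt hr), mul_div_cancel₀ _ (ne_of_gt hr)]
  have h := hasDerivAt_integral_sin_mul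
    (m := fun r => r ^ (2 * s - 1) * Real.exp (-(t * r ^ (2 * s))))
    (by fun_prop) ((integrableOn_rpow_mul_stretchedExp hs0 ht (by linarith)).congr_fun
      (fun r hr => (e r hr).symm) measurableSet_Ioi) x
  rw [funext (mul_fracHeatKernel_eq hs0 ht)]
  convert! (h.const_mul (1 / π)).const_mul (2 * s * t) using 1
  unfold fracHeatFlux
  congr 2
  refine setIntegral_congr_fun measurableSet_Ioi fun r hr => ?_
  rw [e r hr]

lemma abs_fracHeatKernel_le (hs0 : 0 < s) (ht : 0 < t) (x : ℝ) :
    |fracHeatKernel s t x| ≤ 1 / π * ∫ r in Ioi (0 : ℝ), Real.exp (-(t * r ^ (2 * s))) := by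
  unfold fracHeatKernel
  rw [abs_mul, abs_of_pos (by positivity : 0 < 1 / π), ← Real.norm_eq_abs (integral _ _)]
  refine mul_le_mul_of_nonneg_left ?_ (by positivity)
  refine norm_integral_le_of_norm_le (integrableOn_stretchedExp hs0 ht) (ae_of_all _ fun r => ?_)
  rw [norm_mul, Real.norm_of_nonneg (Real.exp_nonneg _)]
  exact mul_le_of_le_one_left (Real.exp_nonneg _) (Real.abs_cos_le_one _)

/-- The kernel is self-similar: it is `p(1, ·)` rescaled. -/
lemma fracHeatKernel_scaling (hs0 : 0 < s) (ht : 0 < t) (x : ℝ) :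
    fracHeatKernel s t x =
      t ^ (-(1 / (2 * s))) * fracHeatKernel s 1 (x * t ^ (-(1 / (2 * s)))) := by
  have hc : 0 < t ^ (-(1 / (2 * s))) := Real.rpow_pos_of_pos ht _
  have h := integral_comp_mul_left_Ioi (E := ℝ)
    (fun r : ℝ => Real.cos (x * r) * Real.exp (-(t * r ^ (2 * s)))) 0 hc
  rw [mul_zero, smul_eq_mul] at h
  have e : ∀ r ∈ Ioi (0 : ℝ), Real.cos (x * (t ^ (-(1 / (2 * s))) * r)) *
      Real.exp (-(t * (t ^ (-(1 / (2 * s))) * r) ^ (2 * s))) =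
      Real.cos (x * t ^ (-(1 / (2 * s))) * r) * Real.exp (-(1 * r ^ (2 * s))) := by
    intro r hr
    rw [Real.mul_rpow hc.le (le_of_lt hr), ← Real.rpow_mul ht.le,
      show -(1 / (2 * s)) * (2 * s) = -1 by field_simp, Real.rpow_neg_one, ← mul_assoc,
      ← mul_assoc, mul_inv_cancel₀ ht.ne']
  rw [setIntegral_congr_fun measurableSet_Ioi e] at h
  unfold fracHeatKernel
  rw [h]
  field_simp

/-! ### The kernel as a Fourier transform -/

/-- The Fourier symbol `ξ ↦ exp (-t |2 π ξ| ^ (2s))`, in the normalization of `Real.fourier`. -/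
noncomputable def fracHeatSymbol (s t ξ : ℝ) : ℂ := (Real.exp (-(t * |2 * π * ξ| ^ (2 * s))) : ℝ)

lemma continuous_fracHeatSymbol (hs0 : 0 < s) : Continuous (fracHeatSymbol s t) := by
  have : Continuous fun r : ℝ => r ^ (2 * s) := Real.continuous_rpow_const (by linarith)
  unfold fracHeatSymbol
  exact Complex.continuous_ofReal.comp (Real.continuous_exp.comp
    (continuous_const.mul (this.comp (by fun_prop))).neg)

lemma norm_fracHeatSymbol (s t ξ : ℝ) :
    ‖fracHeatSymbol s t ξ‖ = Real.exp (-(t * |2 * π * ξ| ^ (2 * s))) := by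
  rw [fracHeatSymbol, Complex.norm_real, Real.norm_of_nonneg (Real.exp_nonneg _)]

lemma integrable_comp_abs_of_integrableOn_Ioi {f : ℝ → ℝ} (hf : IntegrableOn f (Ioi 0)) :
    Integrable fun x => f |x| := by
  rw [← integrableOn_univ, ← Iic_union_Ioi (a := (0 : ℝ)), integrableOn_union,
    integrableOn_Iic_iff_integrableOn_Iio]
  have h : IntegrableOn (fun x => f |x|) (Ioi 0) :=
    hf.congr_fun (fun x hx => by rw [abs_of_pos hx]) measurableSet_Ioi
  refine ⟨?_, h⟩
  have e : Iio (0 : ℝ) = (fun x => -x) ⁻¹' Ioi 0 := by ext; simp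
  have := ((Measure.measurePreserving_neg (volume : Measure ℝ)).integrableOn_comp_preimage
    (MeasurableEquiv.neg ℝ).measurableEmbedding).2 h
  rw [e]
  simpa only [Function.comp_def, abs_neg] using this

lemma integrable_pow_mul_fracHeatSymbol (hs0 : 0 < s) (ht : 0 < t) (n : ℕ) :
    Integrable fun ξ : ℝ => ‖ξ‖ ^ n * ‖fracHeatSymbol s t ξ‖ := by
  have h1 : IntegrableOn (fun r : ℝ => r ^ n * Real.exp (-(t * (2 * π * r) ^ (2 * s)))) (Ioi 0) := by
    have h2 := integrableOn_rpow_mul_stretchedExp (s := s) (t := t * (2 * π) ^ (2 * s))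
      (a := n) hs0 (by positivity) (by have : (0 : ℝ) ≤ n := n.cast_nonneg
                                       linarith)
    refine h2.congr_fun (fun r hr => ?_) measurableSet_Ioi
    simp only
    rw [Real.rpow_natCast, Real.mul_rpow (by positivity) (le_of_lt hr), mul_assoc]
  refine (integrable_comp_abs_of_integrableOn_Ioi h1).congr (ae_of_all _ fun ξ => ?_)
  simp only [norm_fracHeatSymbol, Real.norm_eq_abs, abs_mul, abs_of_pos Real.pi_pos,
    Nat.abs_ofNat]

lemma integrable_fracHeatSymbol (hs0 : 0 < s) (ht : 0 < t) : Integrable (fracHeatSymbol s t) := by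
  have := integrable_pow_mul_fracHeatSymbol hs0 ht 0
  simp only [pow_zero, one_mul] at this
  exact (integrable_norm_iff (continuous_fracHeatSymbol hs0).aestronglyMeasurable).1 this

open FourierTransform in
lemma fourier_fracHeatSymbol (hs0 : 0 < s) (ht : 0 < t) (x : ℝ) :
    𝓕 (fracHeatSymbol s t) x = (fracHeatKernel s t x : ℂ) := by
  let E : ℝ → ℝ := fun ξ => Real.exp (-(t * |2 * π * ξ| ^ (2 * s)))
  have hE : Integrable E := by
    refine (integrable_fracHeatSymbol hs0 ht).norm.congr (ae_of_all _ fun ξ => ?_)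
    exact norm_fracHeatSymbol s t ξ
  have i1 : Integrable fun ξ => Real.cos (x * (2 * π * ξ)) * E ξ :=
    Integrable.bdd_mul (c := 1) hE (by fun_prop) (ae_of_all _ fun _ => Real.abs_cos_le_one _)
  have i2 : Integrable fun ξ => Real.sin (x * (2 * π * ξ)) * E ξ :=
    Integrable.bdd_mul (c := 1) hE (by fun_prop) (ae_of_all _ fun _ => Real.abs_sin_le_one _)
  have hsin : ∫ ξ, Real.sin (x * (2 * π * ξ)) * E ξ = 0 := by
    have h := integral_neg_eq_self (fun ξ => Real.sin (x * (2 * π * ξ)) * E ξ) volume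
    have e : ∀ ξ, Real.sin (x * (2 * π * -ξ)) * E (-ξ) = -(Real.sin (x * (2 * π * ξ)) * E ξ) := by
      intro ξ
      simp only [E, mul_neg, Real.sin_neg, abs_neg, neg_mul]
    simp_rw [e, integral_neg] at h
    linarith
  have hcos : ∫ ξ, Real.cos (x * (2 * π * ξ)) * E ξ = fracHeatKernel s t x := by
    have h := integral_comp_abs
      (f := fun r : ℝ => Real.cos (x * (2 * π * r)) * Real.exp (-(t * (2 * π * r) ^ (2 * s))))
    have e : ∀ ξ, Real.cos (x * (2 * π * ξ)) * E ξ =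
        Real.cos (x * (2 * π * |ξ|)) * Real.exp (-(t * (2 * π * |ξ|) ^ (2 * s))) := by
      intro ξ
      simp only [E]
      rw [abs_mul, abs_of_pos (by positivity : 0 < 2 * π)]
      congr 1
      rcases abs_choice ξ with h | h <;> rw [h]
      simp only [mul_neg, Real.cos_neg]
    simp_rw [e]
    rw [h, integral_comp_mul_left_Ioi (E := ℝ)
      (fun r : ℝ => Real.cos (x * r) * Real.exp (-(t * r ^ (2 * s)))) 0
      (by positivity : 0 < 2 * π), mul_zero, smul_eq_mul]
    unfold fracHeatKernel
    field_simp
  rw [Real.fourier_real_eq_integral_exp_smul]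
  have e : ∀ ξ : ℝ, Complex.exp (↑(-2 * π * ξ * x) * Complex.I) • fracHeatSymbol s t ξ =
      ((Real.cos (x * (2 * π * ξ)) * E ξ : ℝ) : ℂ) -
        ((Real.sin (x * (2 * π * ξ)) * E ξ : ℝ) : ℂ) * Complex.I := by
    intro ξ
    rw [Complex.exp_mul_I, ← Complex.ofReal_cos, ← Complex.ofReal_sin,
      show -2 * π * ξ * x = -(x * (2 * π * ξ)) by ring, Real.cos_neg, Real.sin_neg, smul_eq_mul]
    simp only [fracHeatSymbol, E]
    push_cast
    ring
  simp_rw [e]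
  rw [integral_sub i1.ofReal (i2.ofReal.mul_const _), integral_mul_const, integral_complex_ofReal,
    integral_complex_ofReal, hsin, hcos]
  simp

open FourierTransform in
lemma contDiff_fracHeatKernel (hs0 : 0 < s) (ht : 0 < t) : ContDiff ℝ ∞ (fracHeatKernel s t) := by
  have h : ContDiff ℝ ∞ (𝓕 (fracHeatSymbol s t)) :=
    Real.contDiff_fourier (N := ⊤) fun n _ => integrable_pow_mul_fracHeatSymbol hs0 ht n
  have h2 : fracHeatKernel s t = fun x => Complex.reCLM (𝓕 (fracHeatSymbol s t) x) := by
    funext x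
    rw [fourier_fracHeatSymbol hs0 ht]
    simp
  rw [h2]
  exact Complex.reCLM.contDiff.comp h

lemma continuous_fracHeatKernel (hs0 : 0 < s) (ht : 0 < t) : Continuous (fracHeatKernel s t) :=
  (contDiff_fracHeatKernel hs0 ht).continuous

lemma hasFracLap_fracHeatKernel (hs0 : 0 < s) (hs1 : s < 1) (ht : 0 < t) (x : ℝ) :
    HasFracLap s (fracHeatKernel s t) x (fracHeatFlux s t x) := by
  have h := hasFracLap_of_superposition hs0 hs1 (k := fun x r => Real.cos (x * r))
    (m := fun r => 1 / π * Real.exp (-(t * r ^ (2 * s)))) (u := fracHeatKernel s t)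
    (M := 1 / π * ∫ r in Ioi (0 : ℝ), Real.exp (-(t * r ^ (2 * s))))
    (fun x z r => by rw [add_mul, sub_mul, Real.cos_add, Real.cos_sub]; ring)
    (fun x r => Real.abs_cos_le_one _) (fun x => by fun_prop)
    (fun x => integrableOn_cos_mul ((integrableOn_stretchedExp hs0 ht).const_mul _) x)
    (IntegrableOn.congr_fun (Integrable.const_mul (integrableOn_rpow_mul_stretchedExp hs0 ht
      (a := 2 * s) (by linarith)) (1 / π)) (fun r _ => by ring) measurableSet_Ioi)
    (fun x => by
      unfold fracHeatKernel
      rw [← integral_const_mul]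
      congr 1 with r
      ring)
    (continuous_fracHeatKernel hs0 ht) (abs_fracHeatKernel_le hs0 ht) x
  convert! h using 1
  unfold fracHeatFlux
  rw [← integral_const_mul]
  congr 1 with r
  ring
end

/-! ### Rotation of the contour of integration -/

/-- The integrand of `∫ z ^ a exp (i z - lam z ^ (2s)) dz` along the ray `z = ρ e ^ (iθ)`,
including the factor `e ^ (iθ)` from `dz`. Parametrizing the ray avoids complex powers. -/
noncomputable def rayIntegrand (s a lam ρ θ : ℝ) : ℂ :=
  ((ρ ^ a : ℝ) : ℂ) * Complex.exp (Complex.I * ((1 + a) * θ) +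
    Complex.I * ρ * Complex.exp (Complex.I * θ) -
    lam * ((ρ ^ (2 * s) : ℝ) : ℂ) * Complex.exp (Complex.I * (2 * s * θ)))

/-- The integral of `z ^ a exp (i z - lam z ^ (2s))` along the ray of argument `θ`. -/
noncomputable def rayIntegral (s a lam θ : ℝ) : ℂ := ∫ ρ in Ioi (0 : ℝ), rayIntegrand s a lam ρ θ

lemma norm_rayIntegrand (s a lam : ℝ) {ρ : ℝ} (hρ : 0 ≤ ρ) (θ : ℝ) :
    ‖rayIntegrand s a lam ρ θ‖ = ρ ^ a *
      Real.exp (-(ρ * Real.sin θ + lam * ρ ^ (2 * s) * Real.cos (2 * s * θ))) := by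
  rw [rayIntegrand, norm_mul, Complex.norm_real, Real.norm_of_nonneg (Real.rpow_nonneg hρ _),
    Complex.norm_exp]
  congr 2
  have e1 : Complex.exp (Complex.I * θ) = Real.cos θ + Real.sin θ * Complex.I := by
    rw [mul_comm, Complex.exp_mul_I, Complex.ofReal_cos, Complex.ofReal_sin]
  have e2 : Complex.exp (Complex.I * (2 * s * θ)) =
      Real.cos (2 * s * θ) + Real.sin (2 * s * θ) * Complex.I := by
    rw [mul_comm, Complex.exp_mul_I, Complex.ofReal_cos, Complex.ofReal_sin]
    push_cast
    rfl
  rw [e1, e2]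
  simp only [Complex.sub_re, Complex.add_re, Complex.mul_re, Complex.mul_im, Complex.I_re,
    Complex.I_im, Complex.ofReal_re, Complex.ofReal_im, Complex.add_im, Complex.one_re,
    Complex.one_im]
  ring

lemma measurable_rayIntegrand (s a lam θ : ℝ) : Measurable fun ρ => rayIntegrand s a lam ρ θ := by
  unfold rayIntegrand
  fun_prop

/-- The derivative in the angle is `i` times the derivative in the radius of `ρ` times the integrand,
computed in `hasDerivAt_mul_rayIntegrand_radius`. -/
lemma hasDerivAt_rayIntegrand_angle (s a lam ρ θ : ℝ) :
    HasDerivAt (fun θ => rayIntegrand s a lam ρ θ)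
      (Complex.I * (rayIntegrand s a lam ρ θ * (1 + a +
        (Complex.I * ρ * Complex.exp (Complex.I * θ) -
          2 * s * lam * ((ρ ^ (2 * s) : ℝ) : ℂ) * Complex.exp (Complex.I * (2 * s * θ)))))) θ := by
  have h0 : HasDerivAt (fun θ : ℝ => (θ : ℂ)) 1 θ := Complex.ofRealCLM.hasDerivAt
  have h1 := h0.const_mul (1 + a : ℂ) |>.const_mul Complex.I
  have h2 := ((h0.const_mul Complex.I).cexp).const_mul (Complex.I * ρ)
  have h3 := (((h0.const_mul (2 * s : ℂ)).const_mul Complex.I).cexp).const_mul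
    (lam * ((ρ ^ (2 * s) : ℝ) : ℂ))
  have h := (((h1.add h2).sub h3).cexp).const_mul ((ρ ^ a : ℝ) : ℂ)
  convert! h using 1
  simp only [rayIntegrand, Pi.add_apply, Pi.sub_apply]
  ring

lemma hasDerivAt_mul_rayIntegrand_radius (s a lam θ : ℝ) {ρ : ℝ} (hρ : 0 < ρ) :
    HasDerivAt (fun ρ : ℝ => (ρ : ℂ) * rayIntegrand s a lam ρ θ)
      (rayIntegrand s a lam ρ θ * (1 + a +
        (Complex.I * ρ * Complex.exp (Complex.I * θ) -
          2 * s * lam * ((ρ ^ (2 * s) : ℝ) : ℂ) * Complex.exp (Complex.I * (2 * s * θ))))) ρ := by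
  have h0 : HasDerivAt (fun ρ : ℝ => (ρ : ℂ)) 1 ρ := Complex.ofRealCLM.hasDerivAt
  have ha := (Real.hasDerivAt_rpow_const (p := a) (Or.inl hρ.ne')).ofReal_comp
  have hs := (Real.hasDerivAt_rpow_const (p := 2 * s) (Or.inl hρ.ne')).ofReal_comp
  have h1 := ((h0.const_mul Complex.I).mul_const (Complex.exp (Complex.I * θ))).const_add
    (Complex.I * ((1 + a) * θ))
  have h2 := (hs.const_mul (lam : ℂ)).mul_const (Complex.exp (Complex.I * (2 * s * θ)))
  have h := h0.mul (ha.mul ((h1.sub h2).cexp))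
  convert! h using 1
  have e1 : ((a * ρ ^ (a - 1) : ℝ) : ℂ) * ρ = a * ((ρ ^ a : ℝ) : ℂ) := by
    rw [← Complex.ofReal_mul, ← Complex.ofReal_mul, mul_assoc, Real.rpow_sub_one hρ.ne',
      div_mul_cancel₀ _ hρ.ne']
  have e2 : ((2 * s * ρ ^ (2 * s - 1) : ℝ) : ℂ) * ρ = 2 * s * ((ρ ^ (2 * s) : ℝ) : ℂ) := by
    rw [← Complex.ofReal_mul, mul_assoc, Real.rpow_sub_one hρ.ne',
      div_mul_cancel₀ _ hρ.ne']
    push_cast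
    ring
  simp only [rayIntegrand, Pi.sub_apply, Pi.mul_apply]
  set X := Complex.exp (Complex.I * ((1 + a) * θ) +
    Complex.I * ρ * Complex.exp (Complex.I * θ) -
    lam * ((ρ ^ (2 * s) : ℝ) : ℂ) * Complex.exp (Complex.I * (2 * s * θ))) with hX
  linear_combination (-X) * e1 + ((ρ ^ a : ℝ) : ℂ) * X * lam *
    Complex.exp (Complex.I * (2 * s * θ)) * e2

/-- The integral along the ray does not depend on the angle, in any range of angles where the
integrand decays uniformly: its derivative in the angle is the integral of a total derivative
in the radius. -/
lemma rayIntegral_eq_of_decay {s a lam α β : ℝ} {B : ℝ → ℝ} (hs : 0 < s) (ha : 0 ≤ a)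
    (hαβ : α < β)
    (hB : ∀ θ ∈ Icc α β, ∀ ρ > 0, B ρ ≤ ρ * Real.sin θ + lam * ρ ^ (2 * s) * Real.cos (2 * s * θ))
    (hint : ∀ b : ℝ, 0 ≤ b → IntegrableOn (fun ρ => ρ ^ b * Real.exp (-B ρ)) (Ioi 0)) :
    rayIntegral s a lam α = rayIntegral s a lam β := by
  have hbound : ∀ θ ∈ Icc α β, ∀ ρ > 0, ‖rayIntegrand s a lam ρ θ‖ ≤ ρ ^ a * Real.exp (-B ρ) := by
    intro θ hθ ρ hρ
    rw [norm_rayIntegrand s a lam (le_of_lt hρ)]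
    exact mul_le_mul_of_nonneg_left (Real.exp_le_exp.2 (neg_le_neg (hB θ hθ ρ hρ)))
      (Real.rpow_nonneg (le_of_lt hρ) _)
  have hcont : ContinuousOn (rayIntegral s a lam) (Icc α β) := by
    refine continuousOn_of_dominated (bound := fun ρ => ρ ^ a * Real.exp (-B ρ))
      (fun θ _ => (measurable_rayIntegrand s a lam θ).aestronglyMeasurable) ?_ (hint a ha) ?_
    · intro θ hθ
      exact (ae_restrict_iff' measurableSet_Ioi).2 (ae_of_all _ fun ρ hρ => hbound θ hθ ρ hρ)
    · refine ae_of_all _ fun ρ => ?_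
      exact fun θ _ => (hasDerivAt_rayIntegrand_angle s a lam ρ θ).continuousAt.continuousWithinAt
  let D : ℝ → ℝ → ℂ := fun θ ρ => rayIntegrand s a lam ρ θ * (1 + a +
    (Complex.I * ρ * Complex.exp (Complex.I * θ) -
      2 * s * lam * ((ρ ^ (2 * s) : ℝ) : ℂ) * Complex.exp (Complex.I * (2 * s * θ))))
  let bd : ℝ → ℝ := fun ρ => (1 + a) * (ρ ^ a * Real.exp (-B ρ)) +
    (ρ ^ (a + 1) * Real.exp (-B ρ) + 2 * s * |lam| * (ρ ^ (a + 2 * s) * Real.exp (-B ρ)))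
  have hbd : IntegrableOn bd (Ioi 0) := by
    refine Integrable.add ((hint a ha).const_mul _) (Integrable.add (hint _ (by linarith)) ?_)
    exact (hint _ (by linarith)).const_mul _
  have hDmeas : ∀ θ, AEStronglyMeasurable (D θ) (volume.restrict (Ioi 0)) := by
    intro θ
    refine Measurable.aestronglyMeasurable ?_
    exact (measurable_rayIntegrand s a lam θ).mul (by fun_prop)
  have hDle : ∀ θ ∈ Icc α β, ∀ ρ > 0, ‖D θ ρ‖ ≤ bd ρ := by
    intro θ hθ ρ hρ
    have n1 : ‖Complex.exp (Complex.I * θ)‖ = 1 := by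
      rw [mul_comm]; exact Complex.norm_exp_ofReal_mul_I θ
    have n2 : ‖Complex.exp (Complex.I * (2 * s * θ))‖ = 1 := by
      have := Complex.norm_exp_ofReal_mul_I (2 * s * θ)
      rw [mul_comm]
      push_cast at this
      exact this
    have hsnn : 0 ≤ ρ ^ (2 * s) := Real.rpow_nonneg (le_of_lt hρ) _
    have n3 : ‖(1 + a : ℂ) + (Complex.I * ρ * Complex.exp (Complex.I * θ) -
        2 * s * lam * ((ρ ^ (2 * s) : ℝ) : ℂ) * Complex.exp (Complex.I * (2 * s * θ)))‖ ≤
        (1 + a) + (ρ + 2 * s * |lam| * ρ ^ (2 * s)) := by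
      refine (norm_add_le _ _).trans (add_le_add ?_ ((norm_sub_le _ _).trans (add_le_add ?_ ?_)))
      · rw [show (1 + a : ℂ) = ((1 + a : ℝ) : ℂ) by push_cast; rfl, Complex.norm_real,
          Real.norm_of_nonneg (by linarith)]
      · rw [norm_mul, norm_mul, n1, Complex.norm_I, Complex.norm_real,
          Real.norm_of_nonneg (le_of_lt hρ)]
        simp
      · rw [norm_mul, norm_mul, norm_mul, norm_mul, n2, Complex.norm_real, Complex.norm_real,
          Complex.norm_real, Real.norm_of_nonneg hsnn, Real.norm_of_nonneg hs.le]
        simp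
    calc ‖D θ ρ‖ ≤ (ρ ^ a * Real.exp (-B ρ)) * ((1 + a) + (ρ + 2 * s * |lam| * ρ ^ (2 * s))) := by
          rw [norm_mul]
          exact mul_le_mul (hbound θ hθ ρ hρ) n3 (norm_nonneg _)
            (mul_nonneg (Real.rpow_nonneg (le_of_lt hρ) _) (Real.exp_nonneg _))
      _ = bd ρ := by
          simp only [bd]
          rw [Real.rpow_add hρ, Real.rpow_add hρ, Real.rpow_one]
          ring
  have hDint : ∀ θ ∈ Icc α β, IntegrableOn (D θ) (Ioi 0) := fun θ hθ =>
    Integrable.mono' hbd (hDmeas θ)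
      ((ae_restrict_iff' measurableSet_Ioi).2 (ae_of_all _ fun ρ hρ => hDle θ hθ ρ hρ))
  have hDzero : ∀ θ ∈ Icc α β, ∫ ρ in Ioi (0 : ℝ), D θ ρ = 0 := by
    intro θ hθ
    have hfint : IntegrableOn (fun ρ : ℝ => (ρ : ℂ) * rayIntegrand s a lam ρ θ) (Ioi 0) := by
      refine Integrable.mono' (hint (a + 1) (by linarith))
        (by
          refine Measurable.aestronglyMeasurable ?_
          exact Complex.measurable_ofReal.mul (measurable_rayIntegrand s a lam θ))
        ((ae_restrict_iff' measurableSet_Ioi).2 (ae_of_all _ fun ρ hρ => ?_))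
      rw [norm_mul, Complex.norm_real, Real.norm_of_nonneg (le_of_lt hρ), Real.rpow_add hρ,
        Real.rpow_one, mul_comm (ρ ^ a), mul_assoc]
      exact mul_le_mul_of_nonneg_left (hbound θ hθ ρ hρ) (le_of_lt hρ)
    have hd : ∀ ρ ∈ Ioi (0 : ℝ), HasDerivAt (fun ρ : ℝ => (ρ : ℂ) * rayIntegrand s a lam ρ θ)
        (D θ ρ) ρ := fun ρ hρ => hasDerivAt_mul_rayIntegrand_radius s a lam θ hρ
    have h := integral_Ioi_of_hasDerivAt_of_tendsto (a := 0) ?_ hd (hDint θ hθ)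
      (tendsto_zero_of_hasDerivAt_of_integrableOn_Ioi hd (hDint θ hθ) hfint)
    · rw [h]
      simp
    · refine Continuous.continuousWithinAt ?_
      have c1 : Continuous fun r : ℝ => r ^ (2 * s) := Real.continuous_rpow_const (by linarith)
      have c2 : Continuous fun r : ℝ => r ^ a := Real.continuous_rpow_const ha
      unfold rayIntegrand
      fun_prop
  have hderiv : ∀ θ ∈ Ioo α β, HasDerivAt (rayIntegral s a lam) 0 θ := by
    intro θ hθ
    have h := (hasDerivAt_integral_of_dominated_loc_of_deriv_le (μ := volume.restrict (Ioi 0))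
      (F := fun θ ρ => rayIntegrand s a lam ρ θ) (F' := fun θ ρ => Complex.I * D θ ρ)
      (bound := bd) (Ioo_mem_nhds hθ.1 hθ.2) ?_ ?_ ?_ ?_ hbd ?_).2
    · rw [integral_const_mul, hDzero θ (Ioo_subset_Icc_self hθ), mul_zero] at h
      exact h
    · exact Eventually.of_forall fun θ => (measurable_rayIntegrand s a lam θ).aestronglyMeasurable
    · refine Integrable.mono' (hint a ha) (measurable_rayIntegrand s a lam θ).aestronglyMeasurable ?_
      exact (ae_restrict_iff' measurableSet_Ioi).2
        (ae_of_all _ fun ρ hρ => hbound θ (Ioo_subset_Icc_self hθ) ρ hρ)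
    · exact (hDmeas θ).const_mul _
    · refine (ae_restrict_iff' measurableSet_Ioi).2 (ae_of_all _ fun ρ hρ θ hθ => ?_)
      rw [norm_mul, Complex.norm_I, one_mul]
      exact hDle θ (Ioo_subset_Icc_self hθ) ρ hρ
    · exact ae_of_all _ fun ρ θ _ => hasDerivAt_rayIntegrand_angle s a lam ρ θ
  have hconst : ∀ γ ∈ Ioo α β, rayIntegral s a lam γ = rayIntegral s a lam β := by
    intro γ hγ
    refine (constant_of_has_deriv_right_zero (hcont.mono (Icc_subset_Icc_left hγ.1.le)) ?_ β
      ⟨hγ.2.le, le_rfl⟩).symm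
    intro x hx
    exact (hderiv x ⟨hγ.1.trans_le hx.1, hx.2⟩).hasDerivWithinAt
  have hlim := (hcont α ⟨le_rfl, hαβ.le⟩).tendsto.mono_left
    (nhdsWithin_mono α (Ioo_subset_Icc_self (a := α) (b := β)))
  have hlim2 : Tendsto (rayIntegral s a lam) (𝓝[Ioo α β] α) (𝓝 (rayIntegral s a lam β)) := by
    refine tendsto_const_nhds.congr' ?_
    filter_upwards [self_mem_nhdsWithin] with γ hγ
    exact (hconst γ hγ).symm
  have : (𝓝[Ioo α β] α).NeBot := left_nhdsWithin_Ioo_neBot hαβ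
  exact tendsto_nhds_unique hlim hlim2

/-- With damping, the ray can be rotated from the real axis to the argument `π / 4`: as `s < 1`, the
real part of `z ^ (2s)` stays positive on the way. -/
lemma rayIntegral_eq_pi_div_four {s a lam : ℝ} (hs0 : 0 < s) (hs1 : s < 1) (ha : 0 ≤ a)
    (hl : 0 < lam) : rayIntegral s a lam 0 = rayIntegral s a lam (π / 4) := by
  have hc : 0 < Real.cos (2 * s * (π / 4)) := by
    apply Real.cos_pos_of_mem_Ioo
    constructor <;> nlinarith [Real.pi_pos]
  refine rayIntegral_eq_of_decay (B := fun ρ => lam * Real.cos (2 * s * (π / 4)) * ρ ^ (2 * s)) hs0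
    ha (by positivity) ?_ ?_
  · intro θ hθ ρ hρ
    have h1 : 0 ≤ Real.sin θ :=
      Real.sin_nonneg_of_nonneg_of_le_pi hθ.1 (by linarith [hθ.2, Real.pi_pos])
    have h2 : Real.cos (2 * s * (π / 4)) ≤ Real.cos (2 * s * θ) := by
      apply Real.cos_le_cos_of_nonneg_of_le_pi
      · have := hθ.1
        positivity
      · nlinarith [Real.pi_pos]
      · exact mul_le_mul_of_nonneg_left hθ.2 (by linarith)
    have h3 : 0 ≤ ρ ^ (2 * s) := Real.rpow_nonneg (le_of_lt hρ) _
    have h4 : 0 ≤ ρ * Real.sin θ := mul_nonneg (le_of_lt hρ) h1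
    have h5 := mul_le_mul_of_nonneg_left h2 (mul_nonneg hl.le h3)
    linarith
  · intro b hb
    exact integrableOn_rpow_mul_stretchedExp hs0 (mul_pos hl hc) (by linarith)

lemma integrableOn_rpow_mul_exp_neg_sin {b : ℝ} (hb : 0 ≤ b) :
    IntegrableOn (fun ρ : ℝ => ρ ^ b * Real.exp (-(ρ * Real.sin (π / 4)))) (Ioi 0) := by
  have h1 : 0 < Real.sin (π / 4) :=
    Real.sin_pos_of_pos_of_lt_pi (by positivity) (by linarith [Real.pi_pos])
  have h := integrableOn_rpow_mul_stretchedExp (s := 1 / 2) (a := b) (by norm_num) h1 (by linarith)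
  refine h.congr_fun (fun ρ _ => ?_) measurableSet_Ioi
  simp only [mul_one_div_cancel (two_ne_zero' ℝ), Real.rpow_one, mul_comm]

/-- Without damping the integral along the ray is evaluated on the imaginary axis, where it is
Euler's integral for the Gamma function. -/
lemma rayIntegral_zero_re {s a : ℝ} (hs0 : 0 < s) (ha : 0 ≤ a) :
    (rayIntegral s a 0 (π / 4)).re = -(Real.sin (π * a / 2) * Real.Gamma (a + 1)) := by
  have h := rayIntegral_eq_of_decay (s := s) (a := a) (lam := 0) (α := π / 4) (β := π / 2)
    (B := fun ρ => ρ * Real.sin (π / 4)) hs0 ha (by linarith [Real.pi_pos]) ?_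
    (fun b hb => integrableOn_rpow_mul_exp_neg_sin hb)
  · rw [h]
    have e : ∀ ρ : ℝ, rayIntegrand s a 0 ρ (π / 2) =
        Complex.exp (((π / 2 * (1 + a) : ℝ) : ℂ) * Complex.I) *
          ((Real.exp (-ρ) * ρ ^ (a + 1 - 1) : ℝ) : ℂ) := by
      intro ρ
      unfold rayIntegrand
      have e1 : Complex.exp (Complex.I * ((π / 2 : ℝ) : ℂ)) = Complex.I := by
        rw [mul_comm]
        push_cast
        exact Complex.exp_pi_div_two_mul_I
      rw [e1, add_sub_cancel_right, show Complex.I * ρ * Complex.I = -(ρ : ℂ) by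
          linear_combination (ρ : ℂ) * Complex.I_mul_I]
      push_cast
      simp only [zero_mul, sub_zero, Complex.exp_add]
      rw [show Complex.I * ((1 + (a : ℂ)) * (π / 2)) = π / 2 * (1 + a) * Complex.I by ring]
      ring
    unfold rayIntegral
    simp_rw [e]
    rw [integral_const_mul, integral_complex_ofReal, ← Real.Gamma_eq_integral (by linarith),
      Complex.exp_ofReal_mul_I, Complex.re_mul_ofReal]
    simp only [Complex.add_re, Complex.ofReal_re, Complex.mul_re, Complex.I_re, Complex.I_im,
      Complex.ofReal_im]
    rw [show π / 2 * (1 + a) = π * a / 2 + π / 2 by ring, Real.cos_add_pi_div_two]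
    ring
  · intro θ hθ ρ hρ
    have : Real.sin (π / 4) ≤ Real.sin θ := by
      apply Real.sin_le_sin_of_le_of_le_pi_div_two _ hθ.2 hθ.1
      linarith [Real.pi_pos]
    simp only [zero_mul, add_zero]
    exact mul_le_mul_of_nonneg_left this (le_of_lt hρ)

lemma rayIntegral_angle_zero_re {s a lam : ℝ} (hs0 : 0 < s) (ha : 0 ≤ a) (hl : 0 < lam) :
    (rayIntegral s a lam 0).re =
      ∫ ρ in Ioi (0 : ℝ), Real.cos ρ * (ρ ^ a * Real.exp (-(lam * ρ ^ (2 * s)))) := by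
  have hint : IntegrableOn (fun ρ => rayIntegrand s a lam ρ 0) (Ioi 0) := by
    refine Integrable.mono' (integrableOn_rpow_mul_stretchedExp (a := a) hs0 hl (by linarith))
      (measurable_rayIntegrand s a lam 0).aestronglyMeasurable
      ((ae_restrict_iff' measurableSet_Ioi).2 (ae_of_all _ fun ρ hρ => ?_))
    rw [norm_rayIntegrand s a lam (le_of_lt hρ)]
    simp
  have := integral_re hint
  unfold rayIntegral
  rw [show ∀ z : ℂ, z.re = RCLike.re z from fun _ => rfl, ← this]
  refine setIntegral_congr_fun measurableSet_Ioi fun ρ hρ => ?_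
  show (rayIntegrand s a lam ρ 0).re = _
  unfold rayIntegrand
  have : Complex.I * ((1 + a) * ((0 : ℝ) : ℂ)) + Complex.I * ρ * Complex.exp (Complex.I * (0 : ℝ)) -
      lam * ((ρ ^ (2 * s) : ℝ) : ℂ) * Complex.exp (Complex.I * (2 * s * (0 : ℝ))) =
      ((-(lam * ρ ^ (2 * s)) : ℝ) : ℂ) + ρ * Complex.I := by
    push_cast
    simp
    ring
  rw [this, Complex.exp_add, ← Complex.ofReal_exp, Complex.re_ofReal_mul, Complex.re_ofReal_mul,
    Complex.exp_ofReal_mul_I_re]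
  ring

/-! ### Expansion for small damping -/

lemma norm_sub_le_of_deriv_le_re_nonneg {g g' : ℂ → ℂ} {w : ℂ} {K : ℝ} (hw : 0 ≤ w.re)
    (hg : ∀ z, HasDerivAt g (g' z) z) (hK : ∀ z : ℂ, 0 ≤ z.re → ‖z‖ ≤ ‖w‖ → ‖g' z‖ ≤ K) :
    ‖g w - g 0‖ ≤ K * ‖w‖ := by
  have hconv : Convex ℝ ({z : ℂ | 0 ≤ z.re} ∩ Metric.closedBall 0 ‖w‖) :=
    (convex_halfSpace_re_ge 0).inter (convex_closedBall 0 _)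
  have := hconv.norm_image_sub_le_of_norm_hasDerivWithin_le (f := g) (f' := g') (C := K)
    (x := 0) (y := w) (fun z _ => (hg z).hasDerivWithinAt)
    (fun z hz => hK z hz.1 (by simpa using hz.2)) (by simp) (by simp [hw])
  simpa using this

lemma norm_exp_neg_sub_one_le {w : ℂ} (hw : 0 ≤ w.re) : ‖Complex.exp (-w) - 1‖ ≤ ‖w‖ := by
  have h := norm_sub_le_of_deriv_le_re_nonneg (g := fun z => Complex.exp (-z))
    (g' := fun z => -Complex.exp (-z)) (K := 1) hw
    (fun z => by simpa using (hasDerivAt_id z).fun_neg.cexp)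
    (fun z hz _ => by
      rw [norm_neg, Complex.norm_exp]
      simpa using hz)
  simpa using h

lemma norm_exp_neg_sub_one_add_le {w : ℂ} (hw : 0 ≤ w.re) :
    ‖Complex.exp (-w) - 1 + w‖ ≤ ‖w‖ ^ 2 := by
  have h := norm_sub_le_of_deriv_le_re_nonneg (g := fun z => Complex.exp (-z) + z)
    (g' := fun z => -(Complex.exp (-z) - 1)) (K := ‖w‖) hw
    (fun z => by
      convert! ((hasDerivAt_id z).fun_neg.cexp).add (hasDerivAt_id z) using 1
      simp
      ring)
    (fun z hz hzw => by
      rw [norm_neg]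
      exact (norm_exp_neg_sub_one_le hz).trans hzw)
  rw [sq]
  convert h using 2
  simp
  ring

lemma norm_one_add_mul_exp_neg_sub_le {w : ℂ} (hw : 0 ≤ w.re) :
    ‖(1 + w) * Complex.exp (-w) - 1 + w ^ 2 / 2‖ ≤ ‖w‖ ^ 3 := by
  have h := norm_sub_le_of_deriv_le_re_nonneg
    (g := fun z => (1 + z) * Complex.exp (-z) + z ^ 2 / 2)
    (g' := fun z => -(z * (Complex.exp (-z) - 1))) (K := ‖w‖ ^ 2) hw
    (fun z => by
      have h1 := ((hasDerivAt_id z).const_add 1).mul ((hasDerivAt_id z).fun_neg.cexp)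
      have h2 := ((hasDerivAt_id z).pow 2).div_const 2
      convert! h1.add h2 using 1
      simp
      ring)
    (fun z hz hzw => by
      rw [norm_neg, norm_mul, sq]
      exact mul_le_mul hzw ((norm_exp_neg_sub_one_le hz).trans hzw) (norm_nonneg _)
        (norm_nonneg _))
  rw [show ‖w‖ ^ 3 = ‖w‖ ^ 2 * ‖w‖ by ring]
  convert h using 2
  simp
  ring

lemma integrableOn_rayIntegrand_pi_div_four {s a lam : ℝ} (hs0 : 0 < s) (hs1 : s < 1) (ha : 0 ≤ a)
    (hl : 0 ≤ lam) : IntegrableOn (fun ρ => rayIntegrand s a lam ρ (π / 4)) (Ioi 0) := by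
  have hc : 0 < Real.cos (2 * s * (π / 4)) := by
    apply Real.cos_pos_of_mem_Ioo
    constructor <;> nlinarith [Real.pi_pos]
  refine Integrable.mono' (integrableOn_rpow_mul_exp_neg_sin ha)
    (measurable_rayIntegrand s a lam _).aestronglyMeasurable
    ((ae_restrict_iff' measurableSet_Ioi).2 (ae_of_all _ fun ρ hρ => ?_))
  have h3 : 0 ≤ ρ ^ (2 * s) := Real.rpow_nonneg (le_of_lt hρ) _
  rw [norm_rayIntegrand s a lam (le_of_lt hρ)]
  refine mul_le_mul_of_nonneg_left (Real.exp_le_exp.2 (neg_le_neg ?_))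
    (Real.rpow_nonneg (le_of_lt hρ) _)
  have := mul_nonneg (mul_nonneg hl h3) hc.le
  linarith

/-- The damping exponent `lam z ^ (2s)` on the ray of argument `π / 4`. -/
noncomputable def rayDamping (s lam ρ : ℝ) : ℂ :=
  lam * ((ρ ^ (2 * s) : ℝ) : ℂ) * Complex.exp (Complex.I * (2 * s * ((π / 4 : ℝ) : ℂ)))

lemma rayDamping_re_nonneg {s lam ρ : ℝ} (hs0 : 0 < s) (hs1 : s < 1) (hl : 0 ≤ lam) (hρ : 0 ≤ ρ) :
    0 ≤ (rayDamping s lam ρ).re := by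
  have hc : 0 < Real.cos (2 * s * (π / 4)) := by
    apply Real.cos_pos_of_mem_Ioo
    constructor <;> nlinarith [Real.pi_pos]
  have h3 : 0 ≤ ρ ^ (2 * s) := Real.rpow_nonneg hρ _
  have e : Complex.I * (2 * s * ((π / 4 : ℝ) : ℂ)) = ((2 * s * (π / 4) : ℝ) : ℂ) * Complex.I := by
    push_cast
    ring
  rw [rayDamping, e, ← Complex.ofReal_mul, Complex.re_ofReal_mul, Complex.exp_ofReal_mul_I_re]
  positivity

lemma norm_rayDamping {s lam ρ : ℝ} (hl : 0 ≤ lam) (hρ : 0 ≤ ρ) :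
    ‖rayDamping s lam ρ‖ = lam * ρ ^ (2 * s) := by
  have h3 : 0 ≤ ρ ^ (2 * s) := Real.rpow_nonneg hρ _
  have e : Complex.I * (2 * s * ((π / 4 : ℝ) : ℂ)) = ((2 * s * (π / 4) : ℝ) : ℂ) * Complex.I := by
    push_cast
    ring
  rw [rayDamping, e, ← Complex.ofReal_mul, norm_mul, Complex.norm_exp_ofReal_mul_I,
    Complex.norm_real, Real.norm_of_nonneg (mul_nonneg hl h3), mul_one]

lemma rayIntegrand_damping (s lam ρ : ℝ) : rayIntegrand s 0 lam ρ (π / 4) =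
    rayIntegrand s 0 0 ρ (π / 4) * Complex.exp (-rayDamping s lam ρ) := by
  unfold rayIntegrand rayDamping
  simp only [Complex.ofReal_zero, zero_mul, sub_eq_add_neg, neg_zero, add_zero,
    Complex.exp_add]
  ring

/-- Multiplication of the integrand by the damping exponent raises the power `a` by `2s`. -/
lemma rayIntegrand_mul_damping (s lam lam' : ℝ) {a ρ : ℝ} (hρ : 0 < ρ) :
    (lam' : ℂ) * rayIntegrand s (a + 2 * s) lam ρ (π / 4) =
      rayDamping s lam' ρ * rayIntegrand s a lam ρ (π / 4) := by
  unfold rayIntegrand rayDamping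
  rw [Real.rpow_add hρ, show Complex.I * ((1 + ((a + 2 * s : ℝ) : ℂ)) * ((π / 4 : ℝ) : ℂ)) +
    Complex.I * ρ * Complex.exp (Complex.I * ((π / 4 : ℝ) : ℂ)) -
    lam * ((ρ ^ (2 * s) : ℝ) : ℂ) * Complex.exp (Complex.I * (2 * s * ((π / 4 : ℝ) : ℂ))) =
    Complex.I * (2 * s * ((π / 4 : ℝ) : ℂ)) + (Complex.I * ((1 + a) * ((π / 4 : ℝ) : ℂ)) +
    Complex.I * ρ * Complex.exp (Complex.I * ((π / 4 : ℝ) : ℂ)) -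
    lam * ((ρ ^ (2 * s) : ℝ) : ℂ) * Complex.exp (Complex.I * (2 * s * ((π / 4 : ℝ) : ℂ)))) by
      push_cast
      ring, Complex.exp_add]
  push_cast
  ring

/-- The remainder after expanding the integrand to the order `n` is of the size of
`(lam ρ ^ (2s)) ^ n exp (-ρ sin (π / 4))`, whose integral is a multiple of `lam ^ n`. -/
lemma norm_integral_rayRemainder_le {s lam : ℝ} (hl : 0 ≤ lam) (n : ℕ) {G : ℂ → ℂ}
    (hG : ∀ w : ℂ, 0 ≤ w.re → ‖G w‖ ≤ ‖w‖ ^ n) (hs0 : 0 < s) (hs1 : s < 1) :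
    ‖∫ ρ in Ioi (0 : ℝ), rayIntegrand s 0 0 ρ (π / 4) * G (rayDamping s lam ρ)‖ ≤
      lam ^ n * ∫ ρ in Ioi (0 : ℝ), ρ ^ (2 * s * n) * Real.exp (-(ρ * Real.sin (π / 4))) := by
  rw [← integral_const_mul]
  have hn : (0 : ℝ) ≤ 2 * s * n := by positivity
  refine norm_integral_le_of_norm_le ((integrableOn_rpow_mul_exp_neg_sin hn).const_mul _)
    ((ae_restrict_iff' measurableSet_Ioi).2 (ae_of_all _ fun ρ hρ => ?_))
  have hρ0 : 0 ≤ ρ := le_of_lt hρ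
  rw [norm_mul, norm_rayIntegrand s 0 0 hρ0]
  have h1 := hG _ (rayDamping_re_nonneg hs0 hs1 hl hρ0)
  rw [norm_rayDamping hl hρ0, mul_pow, ← Real.rpow_mul_natCast hρ0] at h1
  simp only [Real.rpow_zero, one_mul, zero_mul, add_zero]
  calc _ ≤ Real.exp (-(ρ * Real.sin (π / 4))) * (lam ^ n * ρ ^ (2 * s * n)) :=
        mul_le_mul_of_nonneg_left h1 (Real.exp_nonneg _)
    _ = _ := by ring

lemma rayIntegral_zero_zero_re {s : ℝ} (hs0 : 0 < s) : (rayIntegral s 0 0 (π / 4)).re = 0 := by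
  rw [rayIntegral_zero_re hs0 le_rfl]
  simp

/-- First order expansion in `lam`: the constant term has zero real part, so the damped cosine
integral is linear in `lam` up to `O(lam ^ 2)`. -/
lemma abs_rayIntegral_sub_le {s : ℝ} (hs0 : 0 < s) (hs1 : s < 1) :
    ∃ K : ℝ, ∀ lam : ℝ, 0 < lam → |(rayIntegral s 0 lam 0).re -
      lam * (Real.sin (π * s) * Real.Gamma (2 * s + 1))| ≤ lam ^ 2 * K := by
  refine ⟨_, fun lam hl => le_trans ?_
    (norm_integral_rayRemainder_le hl.le 2 (fun w hw => norm_exp_neg_sub_one_add_le hw) hs0 hs1)⟩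
  have e : ∀ ρ ∈ Ioi (0 : ℝ), rayIntegrand s 0 0 ρ (π / 4) *
      (Complex.exp (-rayDamping s lam ρ) - 1 + rayDamping s lam ρ) =
      rayIntegrand s 0 lam ρ (π / 4) - rayIntegrand s 0 0 ρ (π / 4) +
        lam * rayIntegrand s (0 + 2 * s) 0 ρ (π / 4) := by
    intro ρ hρ
    rw [rayIntegrand_damping s lam, rayIntegrand_mul_damping s 0 lam hρ]
    ring
  have i1 := integrableOn_rayIntegrand_pi_div_four hs0 hs1 le_rfl hl.le
  have i2 := integrableOn_rayIntegrand_pi_div_four hs0 hs1 le_rfl (le_refl (0 : ℝ))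
  have i3 := integrableOn_rayIntegrand_pi_div_four (a := 0 + 2 * s) hs0 hs1 (by linarith)
    (le_refl (0 : ℝ))
  have i12 : Integrable (fun ρ => rayIntegrand s 0 lam ρ (π / 4) - rayIntegrand s 0 0 ρ (π / 4))
    (volume.restrict (Ioi 0)) := i1.sub i2
  rw [setIntegral_congr_fun measurableSet_Ioi e, integral_add i12 (i3.const_mul _),
    integral_sub i1 i2, integral_const_mul]
  refine le_trans (le_of_eq ?_) (Complex.abs_re_le_norm _)
  congr 1
  rw [rayIntegral_eq_pi_div_four hs0 hs1 le_rfl hl]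
  have h1 := rayIntegral_zero_zero_re hs0
  have h2 := rayIntegral_zero_re (a := 0 + 2 * s) hs0 (by linarith)
  unfold rayIntegral at h1 h2 ⊢
  rw [Complex.add_re, Complex.sub_re, Complex.re_ofReal_mul, h1, h2]
  rw [show π * (0 + 2 * s) / 2 = π * s by ring, zero_add]
  ring

/-- The combination belonging to `(1 + w) exp (-w) = 1 - w ^ 2 / 2 + O(w ^ 3)`, with
`w = lam z ^ (2s)`: the linear terms cancel. -/
lemma abs_rayIntegral_add_sub_le {s : ℝ} (hs0 : 0 < s) (hs1 : s < 1) :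
    ∃ K : ℝ, ∀ lam : ℝ, 0 < lam →
      |(rayIntegral s 0 lam 0).re + lam * (rayIntegral s (2 * s) lam 0).re -
        lam ^ 2 * (Real.sin (2 * π * s) * Real.Gamma (4 * s + 1) / 2)| ≤ lam ^ 3 * K := by
  refine ⟨_, fun lam hl => le_trans ?_ (norm_integral_rayRemainder_le hl.le 3
    (fun w hw => norm_one_add_mul_exp_neg_sub_le hw) hs0 hs1)⟩
  have e : ∀ ρ ∈ Ioi (0 : ℝ), rayIntegrand s 0 0 ρ (π / 4) *
      ((1 + rayDamping s lam ρ) * Complex.exp (-rayDamping s lam ρ) - 1 +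
        rayDamping s lam ρ ^ 2 / 2) =
      rayIntegrand s 0 lam ρ (π / 4) + lam * rayIntegrand s (0 + 2 * s) lam ρ (π / 4) -
        rayIntegrand s 0 0 ρ (π / 4) +
        lam ^ 2 / 2 * rayIntegrand s (0 + 2 * s + 2 * s) 0 ρ (π / 4) := by
    intro ρ hρ
    have h1 := rayIntegrand_mul_damping s lam lam (a := 0) hρ
    have h2 := rayIntegrand_mul_damping s 0 lam (a := 0) hρ
    have h3 := rayIntegrand_mul_damping s 0 lam (a := 0 + 2 * s) hρ
    have h4 := rayIntegrand_damping s lam ρ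
    linear_combination (-1) * h1 - rayDamping s lam ρ / 2 * h2 - (lam : ℂ) / 2 * h3
      - (1 + rayDamping s lam ρ) * h4
  have i1 := integrableOn_rayIntegrand_pi_div_four hs0 hs1 le_rfl hl.le
  have i2 := integrableOn_rayIntegrand_pi_div_four hs0 hs1 le_rfl (le_refl (0 : ℝ))
  have i3 := integrableOn_rayIntegrand_pi_div_four (a := 0 + 2 * s) hs0 hs1 (by linarith) hl.le
  have i4 := integrableOn_rayIntegrand_pi_div_four (a := 0 + 2 * s + 2 * s) hs0 hs1 (by linarith)
    (le_refl (0 : ℝ))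
  have i13 : Integrable (fun ρ => rayIntegrand s 0 lam ρ (π / 4) +
    lam * rayIntegrand s (0 + 2 * s) lam ρ (π / 4)) (volume.restrict (Ioi 0)) :=
    i1.add (i3.const_mul _)
  have i132 : Integrable (fun ρ => rayIntegrand s 0 lam ρ (π / 4) +
    lam * rayIntegrand s (0 + 2 * s) lam ρ (π / 4) - rayIntegrand s 0 0 ρ (π / 4))
    (volume.restrict (Ioi 0)) := i13.sub i2
  rw [setIntegral_congr_fun measurableSet_Ioi e, integral_add i132 (i4.const_mul _),
    integral_sub i13 i2, integral_add i1 (i3.const_mul _), integral_const_mul, integral_const_mul]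
  refine le_trans (le_of_eq ?_) (Complex.abs_re_le_norm _)
  congr 1
  rw [rayIntegral_eq_pi_div_four hs0 hs1 le_rfl hl,
    rayIntegral_eq_pi_div_four hs0 hs1 (by linarith) hl]
  have h1 := rayIntegral_zero_zero_re hs0
  have h2 := rayIntegral_zero_re (a := 0 + 2 * s + 2 * s) hs0 (by linarith)
  unfold rayIntegral at h1 h2 ⊢
  rw [show (lam : ℂ) ^ 2 / 2 = ((lam ^ 2 / 2 : ℝ) : ℂ) by push_cast; rfl]
  rw [Complex.add_re, Complex.sub_re, Complex.add_re, Complex.re_ofReal_mul,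
    Complex.re_ofReal_mul, h1, h2]
  rw [show π * (0 + 2 * s + 2 * s) / 2 = 2 * π * s by ring, zero_add,
    show 2 * s + 2 * s = 4 * s by ring]
  ring

/-! ### Asymptotics of the kernel at infinity -/

lemma integral_cos_mul_scale {s t a x : ℝ} (hx : 0 < x) :
    ∫ r in Ioi (0 : ℝ), Real.cos (x * r) * (r ^ a * Real.exp (-(t * r ^ (2 * s)))) =
      x⁻¹ * (x ^ (-a) * ∫ ρ in Ioi (0 : ℝ),
        Real.cos ρ * (ρ ^ a * Real.exp (-(t * x ^ (-(2 * s)) * ρ ^ (2 * s))))) := by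
  have h := integral_comp_mul_left_Ioi (E := ℝ)
    (fun ρ : ℝ => Real.cos ρ * (ρ ^ a * Real.exp (-(t * x ^ (-(2 * s)) * ρ ^ (2 * s))))) 0 hx
  rw [mul_zero, smul_eq_mul] at h
  rw [mul_left_comm, ← h, ← integral_const_mul]
  refine setIntegral_congr_fun measurableSet_Ioi fun r hr => ?_
  have h1 : x ^ (-a) * x ^ a = 1 := by rw [← Real.rpow_add hx]; simp
  have h2 : x ^ (-(2 * s)) * x ^ (2 * s) = 1 := by rw [← Real.rpow_add hx]; simp
  rw [Real.mul_rpow hx.le (le_of_lt hr), Real.mul_rpow hx.le (le_of_lt hr),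
    show t * x ^ (-(2 * s)) * (x ^ (2 * s) * r ^ (2 * s)) =
      t * r ^ (2 * s) * (x ^ (-(2 * s)) * x ^ (2 * s)) by ring, h2, mul_one]
  linear_combination (-(Real.cos (x * r) * r ^ a * Real.exp (-(t * r ^ (2 * s))))) * h1

section
variable {s t : ℝ}

lemma fracHeatKernel_eq_rayIntegral (hs0 : 0 < s) (ht : 0 < t) {x : ℝ} (hx : 0 < x) :
    fracHeatKernel s t x = 1 / π * (x⁻¹ * (rayIntegral s 0 (t * x ^ (-(2 * s))) 0).re) := by
  rw [rayIntegral_angle_zero_re hs0 le_rfl (by positivity)]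
  have := integral_cos_mul_scale (s := s) (t := t) (a := 0) hx
  simp only [Real.rpow_zero, one_mul, neg_zero] at this ⊢
  rw [← this, fracHeatKernel]

lemma fracHeatFlux_eq_rayIntegral (hs0 : 0 < s) (ht : 0 < t) {x : ℝ} (hx : 0 < x) :
    fracHeatFlux s t x = 1 / π * (x⁻¹ * (x ^ (-(2 * s)) *
      (rayIntegral s (2 * s) (t * x ^ (-(2 * s))) 0).re)) := by
  rw [rayIntegral_angle_zero_re hs0 (by linarith) (by positivity), fracHeatFlux,
    integral_cos_mul_scale hx]

lemma tendsto_rpow_mul_fracHeatKernel (hs0 : 0 < s) (hs1 : s < 1) (ht : 0 < t) :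
    Tendsto (fun x => x ^ (1 + 2 * s) * fracHeatKernel s t x) atTop
      (𝓝 (t / π * (Real.sin (π * s) * Real.Gamma (2 * s + 1)))) := by
  obtain ⟨K, hK⟩ := abs_rayIntegral_sub_le hs0 hs1
  rw [tendsto_iff_norm_sub_tendsto_zero]
  have hlim : Tendsto (fun x : ℝ => 1 / π * (t ^ 2 * K) * x ^ (-(2 * s))) atTop (𝓝 0) := by
    simpa using (tendsto_rpow_neg_atTop (y := 2 * s) (by linarith)).const_mul (1 / π * (t ^ 2 * K))
  refine squeeze_zero' (Eventually.of_forall fun x => norm_nonneg _) ?_ hlim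
  filter_upwards [eventually_gt_atTop 0] with x hx
  have hy : 0 < x ^ (2 * s) := Real.rpow_pos_of_pos hx _
  have h := hK (t * x ^ (-(2 * s))) (by positivity)
  rw [fracHeatKernel_eq_rayIntegral hs0 ht hx, Real.norm_eq_abs]
  rw [Real.rpow_neg hx.le] at h ⊢
  rw [Real.rpow_add hx, Real.rpow_one]
  set J := (rayIntegral s 0 (t * (x ^ (2 * s))⁻¹) 0).re
  set c := Real.sin (π * s) * Real.Gamma (2 * s + 1)
  set y := x ^ (2 * s)
  have e : x * y * (1 / π * (x⁻¹ * J)) - t / π * c = (1 / π * y) * (J - t * y⁻¹ * c) := by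
    field_simp
  rw [e, abs_mul, abs_of_pos (by positivity)]
  calc 1 / π * y * |J - t * y⁻¹ * c| ≤ 1 / π * y * ((t * y⁻¹) ^ 2 * K) :=
        mul_le_mul_of_nonneg_left h (by positivity)
    _ = 1 / π * (t ^ 2 * K) * y⁻¹ := by field_simp

lemma tendsto_rpow_mul_fracHeatKernel_add_flux (hs0 : 0 < s) (hs1 : s < 1) (ht : 0 < t) :
    Tendsto (fun x => x ^ (1 + 4 * s) * (fracHeatKernel s t x + t * fracHeatFlux s t x)) atTop
      (𝓝 (t ^ 2 / π * (Real.sin (2 * π * s) * Real.Gamma (4 * s + 1) / 2))) := by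
  obtain ⟨K, hK⟩ := abs_rayIntegral_add_sub_le hs0 hs1
  rw [tendsto_iff_norm_sub_tendsto_zero]
  have hlim : Tendsto (fun x : ℝ => 1 / π * (t ^ 3 * K) * x ^ (-(2 * s))) atTop (𝓝 0) := by
    simpa using (tendsto_rpow_neg_atTop (y := 2 * s) (by linarith)).const_mul (1 / π * (t ^ 3 * K))
  refine squeeze_zero' (Eventually.of_forall fun x => norm_nonneg _) ?_ hlim
  filter_upwards [eventually_gt_atTop 0] with x hx
  have hy : 0 < x ^ (2 * s) := Real.rpow_pos_of_pos hx _
  have h := hK (t * x ^ (-(2 * s))) (by positivity)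
  rw [fracHeatKernel_eq_rayIntegral hs0 ht hx, fracHeatFlux_eq_rayIntegral hs0 ht hx,
    Real.norm_eq_abs]
  rw [Real.rpow_neg hx.le] at h ⊢
  rw [show 1 + 4 * s = 1 + 2 * s + 2 * s by ring, Real.rpow_add hx, Real.rpow_add hx, Real.rpow_one]
  set J := (rayIntegral s 0 (t * (x ^ (2 * s))⁻¹) 0).re
  set J' := (rayIntegral s (2 * s) (t * (x ^ (2 * s))⁻¹) 0).re
  set c := Real.sin (2 * π * s) * Real.Gamma (4 * s + 1) / 2
  set y := x ^ (2 * s)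
  have e : x * y * y * (1 / π * (x⁻¹ * J) + t * (1 / π * (x⁻¹ * (y⁻¹ * J')))) - t ^ 2 / π * c =
      (1 / π * y ^ 2) * (J + t * y⁻¹ * J' - (t * y⁻¹) ^ 2 * c) := by
    field_simp
  rw [e, abs_mul, abs_of_pos (by positivity)]
  calc _ ≤ 1 / π * y ^ 2 * ((t * y⁻¹) ^ 3 * K) :=
        mul_le_mul_of_nonneg_left h (by positivity)
    _ = 1 / π * (t ^ 3 * K) * y⁻¹ := by field_simp

end

/-! ### Total mass and initial condition -/

section
variable {s t : ℝ}

lemma integrable_fracHeatKernel (hs0 : 0 < s) (hs1 : s < 1) (ht : 0 < t) :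
    Integrable (fracHeatKernel s t) := by
  have hO : fracHeatKernel s t =O[atTop] fun x : ℝ => x ^ (-(1 + 2 * s)) := by
    have h := (tendsto_rpow_mul_fracHeatKernel hs0 hs1 ht).isBigO_one ℝ
    have h2 := h.mul (Asymptotics.isBigO_refl (fun x : ℝ => x ^ (-(1 + 2 * s))) atTop)
    refine (h2.congr' ?_ (Eventually.of_forall fun x => one_mul _))
    filter_upwards [eventually_gt_atTop 0] with x hx
    have h1 : x ^ (1 + 2 * s) * x ^ (-(1 + 2 * s)) = 1 := by rw [← Real.rpow_add hx]; simp
    linear_combination (fracHeatKernel s t x) * h1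
  have h1 : IntegrableOn (fracHeatKernel s t) (Ici 0) :=
    ((continuous_fracHeatKernel hs0 ht).locallyIntegrable.locallyIntegrableOn
      _).integrableOn_of_isBigO_atTop hO
      (integrableAtFilter_rpow_atTop_iff.2 (by linarith))
  refine (integrable_comp_abs_of_integrableOn_Ioi (h1.mono_set Ioi_subset_Ici_self)).congr
    (ae_of_all _ fun x => ?_)
  rcases abs_choice x with h | h
  · simp only [h]
  · simp only [h, fracHeatKernel_neg]

open FourierTransform in
/-- The kernel has mass `1`, by Fourier inversion at the origin. -/
lemma integral_fracHeatKernel (hs0 : 0 < s) (hs1 : s < 1) (ht : 0 < t) :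
    ∫ x, fracHeatKernel s t x = 1 := by
  have hF : 𝓕 (fracHeatSymbol s t) = fun x => (fracHeatKernel s t x : ℂ) :=
    funext (fourier_fracHeatSymbol hs0 ht)
  have h := (continuous_fracHeatSymbol (t := t) hs0).fourierInv_fourier_eq
    (integrable_fracHeatSymbol hs0 ht)
    (by rw [hF]; exact (integrable_fracHeatKernel hs0 hs1 ht).ofReal)
  have h0 := congrFun h 0
  rw [hF, Real.fourierInv_eq'] at h0
  simp only [inner_zero_right, mul_zero, Complex.ofReal_zero, zero_mul, Complex.exp_zero, one_smul]
    at h0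
  rw [integral_complex_ofReal, fracHeatSymbol] at h0
  have h1 := Complex.ofReal_injective h0
  rw [h1, mul_zero, abs_zero, Real.zero_rpow (by linarith)]
  simp

lemma tendsto_integral_fracHeatKernel_mul (hs0 : 0 < s) (hs1 : s < 1) (φ : ℝ →ᵇ ℝ) :
    Tendsto (fun t : ℝ => ∫ x, fracHeatKernel s t x * φ x) (𝓝[>] 0) (𝓝 (φ 0)) := by
  have hp := integrable_fracHeatKernel hs0 hs1 one_pos
  have e : ∀ t : ℝ, 0 < t → ∫ x, fracHeatKernel s t x * φ x =
      ∫ y, fracHeatKernel s 1 y * φ (y * t ^ (1 / (2 * s))) := by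
    intro t ht
    have hc : 0 < t ^ (-(1 / (2 * s))) := Real.rpow_pos_of_pos ht _
    have h := Measure.integral_comp_mul_right
      (fun y => fracHeatKernel s 1 y * φ (y * t ^ (1 / (2 * s)))) (t ^ (-(1 / (2 * s))))
    rw [abs_of_pos (inv_pos.2 hc), smul_eq_mul] at h
    have h1 : t ^ (-(1 / (2 * s))) * t ^ (1 / (2 * s)) = 1 := by
      rw [← Real.rpow_add ht]; simp
    rw [show (∫ y, fracHeatKernel s 1 y * φ (y * t ^ (1 / (2 * s)))) = t ^ (-(1 / (2 * s))) *
      ((t ^ (-(1 / (2 * s))))⁻¹ * ∫ y, fracHeatKernel s 1 y * φ (y * t ^ (1 / (2 * s)))) from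
        (mul_inv_cancel_left₀ hc.ne' _).symm, ← h, ← integral_const_mul]
    congr 1 with x
    rw [fracHeatKernel_scaling hs0 ht x, mul_assoc x, h1]
    ring_nf
  have hlim : Tendsto (fun t : ℝ => ∫ y, fracHeatKernel s 1 y * φ (y * t ^ (1 / (2 * s))))
      (𝓝[>] 0) (𝓝 (∫ y, fracHeatKernel s 1 y * φ 0)) := by
    refine tendsto_integral_filter_of_dominated_convergence
      (fun y => ‖fracHeatKernel s 1 y‖ * ‖φ‖) ?_ ?_ (hp.norm.mul_const _) ?_
    · exact Eventually.of_forall fun t => hp.aestronglyMeasurable.mul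
        (φ.continuous.comp (by fun_prop)).aestronglyMeasurable
    · refine Eventually.of_forall fun t => ae_of_all _ fun y => ?_
      rw [norm_mul]
      exact mul_le_mul_of_nonneg_left (φ.norm_coe_le_norm _) (norm_nonneg _)
    · refine ae_of_all _ fun y => ?_
      have h1 : Tendsto (fun t : ℝ => y * t ^ (1 / (2 * s))) (𝓝 0) (𝓝 0) := by
        have := ((Real.continuous_rpow_const (q := 1 / (2 * s)) (by positivity)).const_mul y).tendsto
          0
        rwa [Real.zero_rpow (by positivity), mul_zero] at this
      exact ((φ.continuous.tendsto 0).comp (h1.mono_left nhdsWithin_le_nhds)).const_mul _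
  rw [integral_mul_const, integral_fracHeatKernel hs0 hs1 one_pos, one_mul] at hlim
  refine hlim.congr' ?_
  filter_upwards [self_mem_nhdsWithin] with t ht
  exact (e t ht).symm

end

/-! ### Limits of characteristic functions have nonnegative Fourier transforms -/

open FourierTransform in
/-- By Fubini this transform is the average over `μ` of translates of the transform of the Gaussian,
which is positive. -/
lemma fourier_charFun_mul_gaussian_re_nonneg (μ : Measure ℝ) [IsProbabilityMeasure μ] {b : ℝ}
    (hb : 0 < b) (x : ℝ) :
    0 ≤ (𝓕 (fun ξ : ℝ => charFun μ (2 * π * ξ) * Complex.exp (-π * b * (ξ : ℂ) ^ 2)) x).re := by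
  have hbc : 0 < (b : ℂ).re := by simpa using hb
  have hg : Integrable fun ξ : ℝ => Complex.exp (-π * b * (ξ : ℂ) ^ 2) := by
    have := integrable_cexp_neg_mul_sq (b := (π * b : ℂ))
      (by simpa using mul_pos Real.pi_pos hb)
    simpa [neg_mul] using this
  have hgauss : ∀ y : ℝ, ∃ c : ℝ, 0 ≤ c ∧
      ∫ ξ : ℝ, Complex.exp (((-2 * π * ξ * (x - y) : ℝ) : ℂ) * Complex.I) *
        Complex.exp (-π * b * (ξ : ℂ) ^ 2) = c := by
    intro y
    have h := congrFun (fourier_gaussian_pi hbc) (x - y)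
    rw [Real.fourier_real_eq_integral_exp_smul] at h
    refine ⟨1 / b ^ (1 / 2 : ℝ) * Real.exp (-π / b * (x - y) ^ 2), by positivity, ?_⟩
    simp only [smul_eq_mul] at h
    rw [h]
    push_cast
    rw [Complex.ofReal_cpow hb.le]
    push_cast
    rfl
  choose c hc0 hc using hgauss
  have key : 𝓕 (fun ξ : ℝ => charFun μ (2 * π * ξ) * Complex.exp (-π * b * (ξ : ℂ) ^ 2)) x =
      ∫ y, (c y : ℂ) ∂μ := by
    rw [Real.fourier_real_eq_integral_exp_smul]
    have e : ∀ ξ : ℝ, Complex.exp (((-2 * π * ξ * x : ℝ) : ℂ) * Complex.I) •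
        (charFun μ (2 * π * ξ) * Complex.exp (-π * b * (ξ : ℂ) ^ 2)) =
        ∫ y, Complex.exp (((-2 * π * ξ * (x - y) : ℝ) : ℂ) * Complex.I) *
          Complex.exp (-π * b * (ξ : ℂ) ^ 2) ∂μ := by
      intro ξ
      rw [smul_eq_mul, integral_mul_const, ← mul_assoc, charFun_apply_real, ← integral_const_mul]
      congr 2 with y
      rw [← Complex.exp_add]
      congr 1
      push_cast
      ring
    simp_rw [e]
    rw [integral_integral_swap]
    · simp_rw [hc]
    · have h1 : Integrable (fun p : ℝ × ℝ => Complex.exp (-π * b * (p.1 : ℂ) ^ 2))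
          (volume.prod μ) := hg.comp_fst μ
      refine Integrable.bdd_mul (c := 1) h1 ?_ (ae_of_all _ fun p => ?_)
      · fun_prop
      · exact (Complex.norm_exp_ofReal_mul_I _).le
  rw [key, integral_complex_ofReal, Complex.ofReal_re]
  exact integral_nonneg hc0

/-- A Gaussian factor turns each characteristic function into the transform of a nonnegative
function; the factor is removed by dominated convergence. -/
lemma fourier_re_nonneg_of_tendsto_charFun {G : ℝ → ℂ} (hG : Integrable G) {μ : ℕ → Measure ℝ}
    [∀ n, IsProbabilityMeasure (μ n)]
    (hlim : ∀ ξ, Tendsto (fun n => charFun (μ n) (2 * π * ξ)) atTop (𝓝 (G ξ))) (x : ℝ) :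
    0 ≤ (FourierTransform.fourier G x).re := by
  have h1 : ∀ b : ℝ, 0 < b → 0 ≤ (FourierTransform.fourier
      (fun ξ : ℝ => G ξ * Complex.exp (-π * b * (ξ : ℂ) ^ 2)) x).re := by
    intro b hb
    have hg : Integrable fun ξ : ℝ => Complex.exp (-π * b * (ξ : ℂ) ^ 2) := by
      have := integrable_cexp_neg_mul_sq (b := (π * b : ℂ))
        (by simpa using mul_pos Real.pi_pos hb)
      simpa [neg_mul] using this
    have ht : Tendsto (fun n => FourierTransform.fourier
        (fun ξ : ℝ => charFun (μ n) (2 * π * ξ) * Complex.exp (-π * b * (ξ : ℂ) ^ 2)) x) atTop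
        (𝓝 (FourierTransform.fourier
          (fun ξ : ℝ => G ξ * Complex.exp (-π * b * (ξ : ℂ) ^ 2)) x)) := by
      simp_rw [Real.fourier_real_eq_integral_exp_smul]
      refine tendsto_integral_of_dominated_convergence
        (fun ξ : ℝ => ‖Complex.exp (-π * b * (ξ : ℂ) ^ 2)‖) ?_ hg.norm ?_ ?_
      · intro n
        refine Measurable.aestronglyMeasurable ?_
        have : Measurable fun ξ : ℝ => charFun (μ n) (2 * π * ξ) :=
          measurable_charFun.comp (by fun_prop)
        simp only [smul_eq_mul]
        fun_prop
      · refine fun n => ae_of_all _ fun ξ => ?_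
        rw [norm_smul, Complex.norm_exp_ofReal_mul_I, one_mul, norm_mul]
        exact mul_le_of_le_one_left (norm_nonneg _) (norm_charFun_le_one _)
      · exact ae_of_all _ fun ξ => ((hlim ξ).mul_const _).const_smul _
    exact ge_of_tendsto' ((Complex.continuous_re.tendsto _).comp ht)
      fun n => fourier_charFun_mul_gaussian_re_nonneg (μ n) hb x
  have h2 : Tendsto (fun b : ℝ => FourierTransform.fourier
      (fun ξ : ℝ => G ξ * Complex.exp (-π * b * (ξ : ℂ) ^ 2)) x) (𝓝[>] 0)
      (𝓝 (FourierTransform.fourier G x)) := by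
    simp_rw [Real.fourier_real_eq_integral_exp_smul]
    refine tendsto_integral_filter_of_dominated_convergence (fun ξ : ℝ => ‖G ξ‖) ?_ ?_ hG.norm ?_
    · refine Eventually.of_forall fun b => ?_
      have : AEStronglyMeasurable (fun ξ : ℝ => Complex.exp (((-2 * π * ξ * x : ℝ) : ℂ) * Complex.I))
        volume := by fun_prop
      refine AEStronglyMeasurable.smul this (hG.aestronglyMeasurable.mul (by fun_prop))
    · filter_upwards [self_mem_nhdsWithin] with b hb
      refine ae_of_all _ fun ξ => ?_
      rw [norm_smul, Complex.norm_exp_ofReal_mul_I, one_mul, norm_mul]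
      refine mul_le_of_le_one_right (norm_nonneg _) ?_
      rw [Complex.norm_exp, show (-π * b * (ξ : ℂ) ^ 2) = ((-(π * b * ξ ^ 2) : ℝ) : ℂ) by
        push_cast; ring, Complex.ofReal_re, Real.exp_le_one_iff]
      have : (0 : ℝ) < b := hb
      have := Real.pi_pos
      simp only [Left.neg_nonpos_iff]
      positivity
    · refine ae_of_all _ fun ξ => ?_
      have : Continuous fun b : ℝ => Complex.exp (((-2 * π * ξ * x : ℝ) : ℂ) * Complex.I) •
        (G ξ * Complex.exp (-π * b * (ξ : ℂ) ^ 2)) := by fun_prop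
      have h3 := this.tendsto 0
      simp only [Complex.ofReal_zero, mul_zero, zero_mul, Complex.exp_zero, mul_one] at h3
      exact h3.mono_left nhdsWithin_le_nhds
  refine ge_of_tendsto ((Complex.continuous_re.tendsto _).comp h2) ?_
  filter_upwards [self_mem_nhdsWithin] with b hb
  exact h1 b hb

/-! ### The kernel as a limit of normalized sums of Pareto variables -/

/-- The density of the two-sided Pareto distribution with tail exponent `2s`. -/
noncomputable def paretoDensity (s z : ℝ) : ℝ :=
  (Ioi 1).indicator (fun r => s * (r ^ (1 + 2 * s))⁻¹) |z|

lemma paretoDensity_nonneg {s : ℝ} (hs0 : 0 < s) (z : ℝ) : 0 ≤ paretoDensity s z :=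
  indicator_nonneg (fun _ hr => mul_nonneg hs0.le
    (inv_nonneg.2 (Real.rpow_nonneg (zero_le_one.trans (le_of_lt hr)) _))) _

lemma measurable_paretoDensity (s : ℝ) : Measurable (paretoDensity s) := by
  have : Measurable ((Ioi (1 : ℝ)).indicator (fun r => s * (r ^ (1 + 2 * s))⁻¹)) :=
    (by fun_prop : Measurable fun r : ℝ => s * (r ^ (1 + 2 * s))⁻¹).indicator measurableSet_Ioi
  exact this.comp measurable_norm

lemma integral_mul_paretoDensity {s : ℝ} (g : ℝ → ℝ) (hg : ∀ z, g |z| = g z) :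
    ∫ z, g z * paretoDensity s z = 2 * ∫ z in Ioi (1 : ℝ), g z * (s * (z ^ (1 + 2 * s))⁻¹) := by
  have h := integral_comp_abs
    (f := fun r => g r * (Ioi 1).indicator (fun r => s * (r ^ (1 + 2 * s))⁻¹) r)
  simp only [hg] at h
  unfold paretoDensity
  rw [h]
  congr 1
  rw [← integral_indicator measurableSet_Ioi, ← integral_indicator measurableSet_Ioi]
  congr 1 with r
  by_cases hr : (1 : ℝ) < r
  · simp [indicator, hr, zero_lt_one.trans hr]
  · simp [indicator, hr]

lemma integrable_paretoDensity {s : ℝ} (hs0 : 0 < s) : Integrable (paretoDensity s) := by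
  refine integrable_comp_abs_of_integrableOn_Ioi (Integrable.integrableOn ?_)
  exact (integrable_indicator_iff measurableSet_Ioi).2
    (Integrable.const_mul (integrableOn_inv_rpow_Ioi hs0 one_pos) s)

lemma integral_paretoDensity {s : ℝ} (hs0 : 0 < s) : ∫ z, paretoDensity s z = 1 := by
  have h := integral_mul_paretoDensity (s := s) (fun _ => 1) (fun _ => rfl)
  simp only [one_mul] at h
  rw [h, integral_const_mul]
  have h1 := integral_Ioi_rpow_of_lt (a := -(1 + 2 * s)) (by linarith) one_pos
  rw [setIntegral_congr_fun measurableSet_Ioi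
    (fun z hz => Real.rpow_neg (zero_le_one.trans (le_of_lt hz)) (1 + 2 * s))] at h1
  rw [h1, Real.one_rpow]
  have : -(1 + 2 * s) + 1 ≠ 0 := by linarith
  field_simp
  ring

/-- The two-sided Pareto distribution with tail exponent `2s`. -/
noncomputable def paretoSymmMeasure (s : ℝ) : Measure ℝ :=
  volume.withDensity fun z => ENNReal.ofReal (paretoDensity s z)

lemma isProbabilityMeasure_paretoSymmMeasure {s : ℝ} (hs0 : 0 < s) :
    IsProbabilityMeasure (paretoSymmMeasure s) := by
  refine ⟨?_⟩
  rw [paretoSymmMeasure, withDensity_apply _ MeasurableSet.univ, Measure.restrict_univ,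
    ← ofReal_integral_eq_lintegral_ofReal (integrable_paretoDensity hs0)
      (ae_of_all _ (paretoDensity_nonneg hs0)), integral_paretoDensity hs0, ENNReal.ofReal_one]

lemma charFun_paretoSymmMeasure {s : ℝ} (hs0 : 0 < s) (ξ : ℝ) :
    charFun (paretoSymmMeasure s) ξ =
      ((1 - 2 * s * |ξ| ^ (2 * s) *
        ∫ z in Ioi |ξ|, (1 - Real.cos z) / z ^ (1 + 2 * s) : ℝ) : ℂ) := by
  have hd := integrable_paretoDensity hs0
  have i1 : Integrable fun z => Real.cos (z * ξ) * paretoDensity s z :=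
    Integrable.bdd_mul (c := 1) hd (by fun_prop) (ae_of_all _ fun _ => Real.abs_cos_le_one _)
  have i2 : Integrable fun z => Real.sin (z * ξ) * paretoDensity s z :=
    Integrable.bdd_mul (c := 1) hd (by fun_prop) (ae_of_all _ fun _ => Real.abs_sin_le_one _)
  have hsin : ∫ z, Real.sin (z * ξ) * paretoDensity s z = 0 := by
    have h := integral_neg_eq_self (fun z => Real.sin (z * ξ) * paretoDensity s z) volume
    have e : ∀ z, Real.sin (-z * ξ) * paretoDensity s (-z) =
        -(Real.sin (z * ξ) * paretoDensity s z) := by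
      intro z
      simp only [paretoDensity, neg_mul, Real.sin_neg, abs_neg]
    simp_rw [e, integral_neg] at h
    linarith
  have hcos : ∫ z, Real.cos (z * ξ) * paretoDensity s z = 1 - 2 * s * |ξ| ^ (2 * s) *
      ∫ z in Ioi |ξ|, (1 - Real.cos z) / z ^ (1 + 2 * s) := by
    have h := integral_mul_paretoDensity (s := s) (fun z => 1 - Real.cos (z * ξ)) (fun z => by
      rcases abs_choice z with h | h <;> simp [h])
    have e1 : ∫ z, (1 - Real.cos (z * ξ)) * paretoDensity s z =
        1 - ∫ z, Real.cos (z * ξ) * paretoDensity s z := by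
      simp_rw [sub_mul, one_mul]
      rw [integral_sub hd i1, integral_paretoDensity hs0]
    rcases eq_or_ne ξ 0 with rfl | hξ
    · simp only [mul_zero, Real.cos_zero, one_mul, abs_zero]
      rw [integral_paretoDensity hs0, Real.zero_rpow (by linarith)]
      simp
    have e2 : ∫ z in Ioi (1 : ℝ), (1 - Real.cos (z * ξ)) * (s * (z ^ (1 + 2 * s))⁻¹) =
        s * (|ξ| ^ (2 * s) * ∫ z in Ioi |ξ|, (1 - Real.cos z) / z ^ (1 + 2 * s)) := by
      have := integral_one_sub_cos_mul (s := s) zero_le_one (abs_pos.2 hξ)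
      rw [one_mul] at this
      rw [← this, ← integral_const_mul]
      refine setIntegral_congr_fun measurableSet_Ioi fun z _ => ?_
      have : Real.cos (z * |ξ|) = Real.cos (z * ξ) := by
        rcases abs_choice ξ with h | h <;> simp [h]
      rw [this]
      ring
    rw [e1, e2] at h
    linarith
  rw [charFun_apply_real, paretoSymmMeasure, integral_withDensity_eq_integral_toReal_smul
    (measurable_paretoDensity s).ennreal_ofReal (ae_of_all _ fun _ => ENNReal.ofReal_lt_top)]
  have e : ∀ z : ℝ, (ENNReal.ofReal (paretoDensity s z)).toReal •
      Complex.exp ((ξ : ℂ) * z * Complex.I) =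
      ((Real.cos (z * ξ) * paretoDensity s z : ℝ) : ℂ) +
        ((Real.sin (z * ξ) * paretoDensity s z : ℝ) : ℂ) * Complex.I := by
    intro z
    rw [ENNReal.toReal_ofReal (paretoDensity_nonneg hs0 z), ← Complex.ofReal_mul,
      Complex.exp_ofReal_mul_I, Complex.real_smul, mul_comm ξ z]
    push_cast
    ring
  simp_rw [e]
  rw [integral_add i1.ofReal (i2.ofReal.mul_const _), integral_mul_const, integral_complex_ofReal,
    integral_complex_ofReal, hsin, hcos]
  simp

lemma exists_charFun_eq_pow (μ : Measure ℝ) [IsProbabilityMeasure μ] (n : ℕ) :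
    ∃ ν : Measure ℝ, IsProbabilityMeasure ν ∧ ∀ ξ, charFun ν ξ = charFun μ ξ ^ n := by
  induction n with
  | zero => exact ⟨Measure.dirac 0, inferInstance, fun ξ => by simp⟩
  | succ n ih =>
    obtain ⟨ν, hν, h⟩ := ih
    refine ⟨ν ∗ μ, inferInstance, fun ξ => ?_⟩
    rw [charFun_conv, h, pow_succ]

/-- The stable limit theorem for sums of Pareto variables, on the level of characteristic
functions. -/
lemma exists_tendsto_charFun_stable {s t : ℝ} (hs0 : 0 < s) (hs1 : s < 1) (ht : 0 < t) :
    ∃ μ : ℕ → Measure ℝ, (∀ n, IsProbabilityMeasure (μ n)) ∧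
      ∀ ξ : ℝ, Tendsto (fun n => charFun (μ n) ξ) atTop
        (𝓝 ((Real.exp (-(t * |ξ| ^ (2 * s))) : ℝ) : ℂ)) := by
  have hP := isProbabilityMeasure_paretoSymmMeasure hs0
  have hA := oneSubCosIntegral_pos hs0 hs1
  set k := t / (2 * s * oneSubCosIntegral s) with hk
  have hk0 : 0 < k := by positivity
  -- the scale making `n` times the exponent of one summand converge to `t |ξ| ^ (2s)`
  let c : ℕ → ℝ := fun n => (k / n) ^ (1 / (2 * s))
  have h0 : ∀ n : ℕ, ∃ ν : Measure ℝ, IsProbabilityMeasure ν ∧ ∀ ξ, charFun ν ξ =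
      charFun ((paretoSymmMeasure s).map (c n * ·)) ξ ^ n := fun n => by
    have : IsProbabilityMeasure ((paretoSymmMeasure s).map (c n * ·)) :=
      Measure.isProbabilityMeasure_map (by fun_prop)
    exact exists_charFun_eq_pow _ n
  choose μ hμ hch using h0
  refine ⟨μ, hμ, fun ξ => ?_⟩
  simp_rw [hch, charFun_map_mul, charFun_paretoSymmMeasure hs0]
  rcases eq_or_ne ξ 0 with rfl | hξ
  · simp [Real.zero_rpow (by linarith : 2 * s ≠ 0)]
  have hc0 : ∀ n : ℕ, 0 < n → 0 < c n := fun n hn => by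
    have : (0 : ℝ) < n := by exact_mod_cast hn
    positivity
  have hclim : Tendsto (fun n => |c n * ξ|) atTop (𝓝[>] 0) := by
    refine tendsto_nhdsWithin_iff.2 ⟨?_, ?_⟩
    · have h1 : Tendsto c atTop (𝓝 0) := by
        have h2 := (Real.continuous_rpow_const (q := 1 / (2 * s)) (by positivity)).tendsto 0
        rw [Real.zero_rpow (by positivity)] at h2
        exact h2.comp (tendsto_const_div_atTop_nhds_zero_nat k)
      simpa using (h1.mul_const ξ).abs
    · filter_upwards [eventually_gt_atTop 0] with n hn
      exact abs_pos.2 (mul_ne_zero (hc0 n hn).ne' hξ)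
  have hmain : Tendsto (fun n : ℕ => (n : ℝ) * -(2 * s * |c n * ξ| ^ (2 * s) *
      ∫ z in Ioi |c n * ξ|, (1 - Real.cos z) / z ^ (1 + 2 * s))) atTop
      (𝓝 (-(t * |ξ| ^ (2 * s)))) := by
    have h1 := ((tendsto_setIntegral_one_sub_cos_Ioi hs0 hs1).comp hclim).const_mul
      (-(2 * s * k * |ξ| ^ (2 * s)))
    have e : -(2 * s * k * |ξ| ^ (2 * s)) * oneSubCosIntegral s = -(t * |ξ| ^ (2 * s)) := by
      rw [hk]
      field_simp
    rw [e] at h1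
    refine h1.congr' ?_
    filter_upwards [eventually_gt_atTop 0] with n hn
    have hn' : (0 : ℝ) < n := by exact_mod_cast hn
    have e2 : |c n * ξ| ^ (2 * s) = k / n * |ξ| ^ (2 * s) := by
      rw [abs_mul, abs_of_pos (hc0 n hn), Real.mul_rpow (hc0 n hn).le (abs_nonneg _),
        ← Real.rpow_mul (by positivity), show 1 / (2 * s) * (2 * s) = 1 by field_simp,
        Real.rpow_one]
    simp only [Function.comp_apply]
    rw [e2]
    field_simp
  have h2 := Real.tendsto_one_add_pow_exp_of_tendsto hmain
  have h3 := (Complex.continuous_ofReal.tendsto _).comp h2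
  refine h3.congr fun n => ?_
  simp [sub_eq_add_neg]

/-! ### Positivity and the fundamental solution -/

section
variable {s t : ℝ}

lemma fracHeatKernel_nonneg (hs0 : 0 < s) (hs1 : s < 1) (ht : 0 < t) (x : ℝ) :
    0 ≤ fracHeatKernel s t x := by
  obtain ⟨μ, hμ, hlim⟩ := exists_tendsto_charFun_stable hs0 hs1 ht
  have h := fourier_re_nonneg_of_tendsto_charFun (integrable_fracHeatSymbol hs0 ht)
    (fun ξ => hlim (2 * π * ξ)) x
  rwa [fourier_fracHeatSymbol hs0 ht, Complex.ofReal_re] at h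

/-- At a zero of the nonnegative kernel the time derivative would vanish, while the strong maximum
principle makes the fractional Laplacian strictly negative there. -/
lemma fracHeatKernel_pos (hs0 : 0 < s) (hs1 : s < 1) (ht : 0 < t) (x : ℝ) :
    0 < fracHeatKernel s t x := by
  refine lt_of_le_of_ne (fracHeatKernel_nonneg hs0 hs1 ht x) fun h0 => ?_
  have hmin : IsLocalMin (fun τ => fracHeatKernel s τ x) t := by
    filter_upwards [Ioi_mem_nhds ht] with τ hτ
    rw [← h0]
    exact fracHeatKernel_nonneg hs0 hs1 hτ x
  have hflux : fracHeatFlux s t x = 0 := by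
    have := hmin.hasDerivAt_eq_zero (hasDerivAt_fracHeatKernel_time hs0 ht x)
    linarith
  obtain ⟨y, hy⟩ : ∃ y, fracHeatKernel s t x < fracHeatKernel s t y := by
    by_contra! hcon
    have : ∀ y, fracHeatKernel s t y = 0 := fun y =>
      le_antisymm (h0 ▸ hcon y) (fracHeatKernel_nonneg hs0 hs1 ht y)
    have h1 := integral_fracHeatKernel hs0 hs1 ht
    simp [this] at h1
  have := (hasFracLap_fracHeatKernel hs0 hs1 ht x).neg_of_isMin hs0 hs1
    (continuous_fracHeatKernel hs0 ht)
    (fun y => h0 ▸ fracHeatKernel_nonneg hs0 hs1 ht y) hy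
  linarith

lemma isFundamentalSolution_fracHeatKernel (hs0 : 0 < s) (hs1 : s < 1) :
    IsFundamentalSolution s (fracHeatKernel s) where
  integrable _ ht := integrable_fracHeatKernel hs0 hs1 ht
  equation _ ht x := ⟨fracHeatFlux s _ x, hasFracLap_fracHeatKernel hs0 hs1 ht x,
    hasDerivAt_fracHeatKernel_time hs0 ht x⟩
  initial φ := tendsto_integral_fracHeatKernel_mul hs0 hs1 φ

end

/-! ### The explicit layer -/

section
variable {s t : ℝ}

lemma intervalIntegral_fracHeatKernel (hs0 : 0 < s) (ht : 0 < t) (x : ℝ) :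
    ∫ y in (0 : ℝ)..x, fracHeatKernel s t y = fracHeatPrimitive s t x := by
  rw [intervalIntegral.integral_eq_sub_of_hasDerivAt
    (fun y _ => hasDerivAt_fracHeatPrimitive hs0 ht y)
    ((continuous_fracHeatKernel hs0 ht).intervalIntegrable _ _), fracHeatPrimitive_zero, sub_zero]

lemma setIntegral_Iic_zero_fracHeatKernel (hs0 : 0 < s) (hs1 : s < 1) (ht : 0 < t) :
    ∫ y in Iic (0 : ℝ), fracHeatKernel s t y = 1 / 2 := by
  have hp := integrable_fracHeatKernel hs0 hs1 ht
  have h1 := intervalIntegral.integral_Iic_add_Ioi (b := (0 : ℝ)) hp.integrableOn hp.integrableOn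
  have h2 := integral_comp_neg_Iic (0 : ℝ) (fracHeatKernel s t)
  simp only [fracHeatKernel_neg, neg_zero] at h2
  rw [integral_fracHeatKernel hs0 hs1 ht, ← h2] at h1
  linarith

lemma explicitLayer_eq_primitive (hs0 : 0 < s) (hs1 : s < 1) (ht : 0 < t) (x : ℝ) :
    explicitLayer s t x = 2 * fracHeatPrimitive s t x := by
  have hp := integrable_fracHeatKernel hs0 hs1 ht
  have h := intervalIntegral.integral_Iic_sub_Iic (a := (0 : ℝ)) (b := x) hp.integrableOn
    hp.integrableOn
  rw [intervalIntegral_fracHeatKernel hs0 ht, setIntegral_Iic_zero_fracHeatKernel hs0 hs1 ht] at h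
  rw [explicitLayer]
  linarith

lemma hasDerivAt_explicitLayer (hs0 : 0 < s) (hs1 : s < 1) (ht : 0 < t) (x : ℝ) :
    HasDerivAt (explicitLayer s t) (2 * fracHeatKernel s t x) x := by
  rw [funext (explicitLayer_eq_primitive hs0 hs1 ht)]
  exact (hasDerivAt_fracHeatPrimitive hs0 ht x).const_mul 2

lemma deriv_explicitLayer (hs0 : 0 < s) (hs1 : s < 1) (ht : 0 < t) :
    deriv (explicitLayer s t) = fun x => 2 * fracHeatKernel s t x :=
  funext fun x => (hasDerivAt_explicitLayer hs0 hs1 ht x).deriv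

lemma contDiff_explicitLayer (hs0 : 0 < s) (hs1 : s < 1) (ht : 0 < t) :
    ContDiff ℝ ∞ (explicitLayer s t) := by
  rw [contDiff_infty_iff_deriv, deriv_explicitLayer hs0 hs1 ht]
  exact ⟨fun x => (hasDerivAt_explicitLayer hs0 hs1 ht x).differentiableAt,
    contDiff_const.mul (contDiff_fracHeatKernel hs0 ht)⟩

lemma continuous_explicitLayer (hs0 : 0 < s) (hs1 : s < 1) (ht : 0 < t) :
    Continuous (explicitLayer s t) := (contDiff_explicitLayer hs0 hs1 ht).continuous

lemma explicitLayer_neg (hs0 : 0 < s) (hs1 : s < 1) (ht : 0 < t) (x : ℝ) :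
    explicitLayer s t (-x) = -explicitLayer s t x := by
  rw [explicitLayer_eq_primitive hs0 hs1 ht, explicitLayer_eq_primitive hs0 hs1 ht,
    fracHeatPrimitive, fracHeatPrimitive]
  simp only [neg_mul, Real.sin_neg, integral_neg]
  ring

lemma strictMono_explicitLayer (hs0 : 0 < s) (hs1 : s < 1) (ht : 0 < t) :
    StrictMono (explicitLayer s t) := by
  refine strictMono_of_deriv_pos fun x => ?_
  rw [deriv_explicitLayer hs0 hs1 ht]
  exact mul_pos two_pos (fracHeatKernel_pos hs0 hs1 ht x)

lemma tendsto_explicitLayer_atTop (hs0 : 0 < s) (hs1 : s < 1) (ht : 0 < t) :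
    Tendsto (explicitLayer s t) atTop (𝓝 1) := by
  have h := (aecover_Iic (μ := (volume : Measure ℝ)) (tendsto_id (x := atTop)))
    |>.integral_tendsto_of_countably_generated (integrable_fracHeatKernel hs0 hs1 ht)
  rw [integral_fracHeatKernel hs0 hs1 ht] at h
  have h2 := (h.const_mul 2).const_add (-1)
  norm_num at h2
  exact h2

lemma tendsto_explicitLayer_atBot (hs0 : 0 < s) (hs1 : s < 1) (ht : 0 < t) :
    Tendsto (explicitLayer s t) atBot (𝓝 (-1)) := by
  have h := ((tendsto_explicitLayer_atTop hs0 hs1 ht).comp tendsto_neg_atBot_atTop).neg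
  refine h.congr fun x => ?_
  rw [Function.comp_apply, explicitLayer_neg hs0 hs1 ht, neg_neg]

end

/-- A strictly increasing function stays strictly between its limits at `±∞`. -/
lemma StrictMono.mem_Ioo_of_tendsto {v : ℝ → ℝ} {a b : ℝ} (hv : StrictMono v)
    (hbot : Tendsto v atBot (𝓝 a)) (htop : Tendsto v atTop (𝓝 b)) (x : ℝ) : v x ∈ Ioo a b :=
  ⟨(hv.monotone.le_of_tendsto hbot (x - 1)).trans_lt (hv (by linarith)),
    (hv (by linarith : x < x + 1)).trans_le (hv.monotone.ge_of_tendsto htop (x + 1))⟩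

section
variable {s t : ℝ}

lemma explicitLayer_mem_Ioo (hs0 : 0 < s) (hs1 : s < 1) (ht : 0 < t) (x : ℝ) :
    explicitLayer s t x ∈ Ioo (-1 : ℝ) 1 :=
  (strictMono_explicitLayer hs0 hs1 ht).mem_Ioo_of_tendsto (tendsto_explicitLayer_atBot hs0 hs1 ht)
    (tendsto_explicitLayer_atTop hs0 hs1 ht) x

lemma hasFracLap_explicitLayer (hs0 : 0 < s) (hs1 : s < 1) (ht : 0 < t) (x : ℝ) :
    HasFracLap s (explicitLayer s t) x (x * fracHeatKernel s t x / (s * t)) := by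
  have e2 : ∀ r ∈ Ioi (0 : ℝ), r ^ (2 * s) * (2 / π * (r⁻¹ * Real.exp (-(t * r ^ (2 * s))))) =
      2 / π * (r ^ (2 * s - 1) * Real.exp (-(t * r ^ (2 * s)))) := by
    intro r hr
    rw [Real.rpow_sub_one (ne_of_gt hr)]
    ring
  have h := hasFracLap_of_superposition hs0 hs1 (k := fun x r => Real.sin (x * r))
    (m := fun r => 2 / π * (r⁻¹ * Real.exp (-(t * r ^ (2 * s))))) (u := explicitLayer s t)
    (M := 1)
    (fun x z r => by rw [add_mul, sub_mul, Real.sin_add, Real.sin_sub]; ring)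
    (fun x r => Real.abs_sin_le_one _) (fun x => by fun_prop)
    (fun x => IntegrableOn.congr_fun
      (Integrable.const_mul (integrableOn_sin_div_mul_stretchedExp hs0 ht x) (2 / π))
      (fun r _ => by ring) measurableSet_Ioi)
    (IntegrableOn.congr_fun (Integrable.const_mul (integrableOn_rpow_mul_stretchedExp hs0 ht
      (a := 2 * s - 1) (by linarith)) (2 / π)) (fun r hr => (e2 r hr).symm) measurableSet_Ioi)
    (fun x => by
      rw [explicitLayer_eq_primitive hs0 hs1 ht, fracHeatPrimitive, ← mul_assoc,
        ← integral_const_mul]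
      congr 1 with r
      ring)
    (continuous_explicitLayer hs0 hs1 ht)
    (fun x => abs_le.2 ⟨(explicitLayer_mem_Ioo hs0 hs1 ht x).1.le,
      (explicitLayer_mem_Ioo hs0 hs1 ht x).2.le⟩) x
  convert! h using 1
  rw [setIntegral_congr_fun measurableSet_Ioi
    (fun r hr => congrArg (Real.sin (x * r) * ·) (e2 r hr)), mul_fracHeatKernel_eq hs0 ht x]
  simp_rw [mul_left_comm _ (2 / π)]
  rw [integral_const_mul]
  field_simp

lemma explicitLayer_eq_sine_integral (hs0 : 0 < s) (hs1 : s < 1) (ht : 0 < t) (x : ℝ) :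
    explicitLayer s t x =
      2 / π * ∫ r in Ioi (0 : ℝ), Real.sin (x * r) / r * Real.exp (-(t * r ^ (2 * s))) := by
  rw [explicitLayer_eq_primitive hs0 hs1 ht, fracHeatPrimitive_eq]
  ring

lemma integrableOn_sinc_mul_stretchedExp (hs0 : 0 < s) (ht : 0 < t) {x : ℝ} (hx : x ≠ 0) :
    IntegrableOn (fun z : ℝ => Real.sin z / z * Real.exp (-(t * (z / |x|) ^ (2 * s)))) (Ioi 0) := by
  have hx0 : 0 < |x| := abs_pos.2 hx
  have h := integrableOn_sin_div_mul_stretchedExp (s := s) (t := t * |x| ^ (-(2 * s))) hs0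
    (by positivity) 1
  refine h.congr_fun (fun z hz => ?_) measurableSet_Ioi
  simp only [one_mul]
  rw [Real.div_rpow (le_of_lt hz) hx0.le, Real.rpow_neg hx0.le]
  ring_nf

lemma explicitLayer_eq_sinc_integral (hs0 : 0 < s) (hs1 : s < 1) (ht : 0 < t) {x : ℝ}
    (hx : x ≠ 0) :
    explicitLayer s t x = Real.sign x * (2 / π *
      ∫ z in Ioi (0 : ℝ), Real.sin z / z * Real.exp (-(t * (z / |x|) ^ (2 * s)))) := by
  have hpos : ∀ x : ℝ, 0 < x → explicitLayer s t x = 2 / π *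
      ∫ z in Ioi (0 : ℝ), Real.sin z / z * Real.exp (-(t * (z / x) ^ (2 * s))) := by
    intro x hx
    have h := integral_comp_mul_left_Ioi (E := ℝ)
      (fun z : ℝ => Real.sin z / z * Real.exp (-(t * (z / x) ^ (2 * s)))) 0 hx
    rw [mul_zero, smul_eq_mul] at h
    have h2 := congrArg (x * ·) h
    simp only [mul_inv_cancel_left₀ hx.ne'] at h2
    rw [explicitLayer_eq_sine_integral hs0 hs1 ht, ← h2, ← integral_const_mul x]
    congr 1
    refine setIntegral_congr_fun measurableSet_Ioi fun r _ => ?_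
    simp only [mul_div_cancel_left₀ _ hx.ne']
    field_simp
  rcases lt_or_gt_of_ne hx with h | h
  · rw [abs_of_neg h, Real.sign_of_neg h, ← hpos _ (neg_pos.2 h), explicitLayer_neg hs0 hs1 ht]
    ring
  · rw [abs_of_pos h, Real.sign_of_pos h, ← hpos _ h, one_mul]

/-! ### Asymptotics of the layer -/

lemma sin_pi_mul_pos (hs0 : 0 < s) (hs1 : s < 1) : 0 < Real.sin (π * s) :=
  Real.sin_pos_of_pos_of_lt_pi (by positivity) (by nlinarith [Real.pi_pos])

lemma tendsto_rpow_mul_one_sub_explicitLayer (hs0 : 0 < s) (hs1 : s < 1) (ht : 0 < t) :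
    Tendsto (fun x : ℝ => x ^ (2 * s) * (1 - explicitLayer s t x)) atTop
      (𝓝 (t * (2 / π) * Real.sin (π * s) * Real.Gamma (2 * s))) := by
  have hlim := (tendsto_rpow_mul_fracHeatKernel hs0 hs1 ht).const_mul (1 / s)
  have hval : 1 / s * (t / π * (Real.sin (π * s) * Real.Gamma (2 * s + 1))) =
      t * (2 / π) * Real.sin (π * s) * Real.Gamma (2 * s) := by
    rw [Real.Gamma_add_one (by positivity)]
    field_simp
  rw [hval] at hlim
  have h := HasDerivAt.lhopital_zero_atTop (f := fun x => 1 - explicitLayer s t x)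
    (g := fun x : ℝ => x ^ (-(2 * s))) (f' := fun x => -(2 * fracHeatKernel s t x))
    (g' := fun x : ℝ => -(2 * s) * x ^ (-(2 * s) - 1))
    (l := 𝓝 (t * (2 / π) * Real.sin (π * s) * Real.Gamma (2 * s)))
    (Eventually.of_forall fun x => (hasDerivAt_explicitLayer hs0 hs1 ht x).const_sub 1) ?_ ?_ ?_
    (tendsto_rpow_neg_atTop (by linarith)) ?_
  · refine h.congr' ?_
    filter_upwards [eventually_gt_atTop 0] with x hx
    rw [Real.rpow_neg hx.le, div_inv_eq_mul, mul_comm]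
  · filter_upwards [eventually_gt_atTop 0] with x hx
    exact Real.hasDerivAt_rpow_const (Or.inl hx.ne')
  · filter_upwards [eventually_gt_atTop 0] with x hx
    exact mul_ne_zero (by linarith) (Real.rpow_pos_of_pos hx _).ne'
  · simpa using (tendsto_explicitLayer_atTop hs0 hs1 ht).const_sub 1
  · refine hlim.congr' ?_
    filter_upwards [eventually_gt_atTop 0] with x hx
    rw [show -(2 * s) - 1 = -(1 + 2 * s) by ring, Real.rpow_neg hx.le]
    have := (Real.rpow_pos_of_pos hx (1 + 2 * s)).ne'
    field_simp

lemma tendsto_rpow_mul_abs_explicitLayer_sub_one (hs0 : 0 < s) (hs1 : s < 1) (ht : 0 < t) :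
    Tendsto (fun x : ℝ => |x| ^ (2 * s) * |explicitLayer s t x - 1|) atTop
      (𝓝 (t * (2 / π) * Real.sin (π * s) * Real.Gamma (2 * s))) := by
  refine (tendsto_rpow_mul_one_sub_explicitLayer hs0 hs1 ht).congr' ?_
  filter_upwards [eventually_gt_atTop 0] with x hx
  rw [abs_of_pos hx, abs_of_neg (by linarith [(explicitLayer_mem_Ioo hs0 hs1 ht x).2]), neg_sub]

lemma tendsto_rpow_mul_abs_explicitLayer_add_one (hs0 : 0 < s) (hs1 : s < 1) (ht : 0 < t) :
    Tendsto (fun x : ℝ => |x| ^ (2 * s) * |explicitLayer s t x + 1|) atBot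
      (𝓝 (t * (2 / π) * Real.sin (π * s) * Real.Gamma (2 * s))) := by
  refine ((tendsto_rpow_mul_abs_explicitLayer_sub_one hs0 hs1 ht).comp
    tendsto_neg_atBot_atTop).congr fun x => ?_
  rw [Function.comp_apply, abs_neg, explicitLayer_neg hs0 hs1 ht, ← neg_add', abs_neg]

lemma tendsto_rpow_mul_deriv_explicitLayer (hs0 : 0 < s) (hs1 : s < 1) (ht : 0 < t) :
    Tendsto (fun x : ℝ => |x| ^ (1 + 2 * s) * deriv (explicitLayer s t) x) (cocompact ℝ)
      (𝓝 (t * (4 * s / π) * Real.sin (π * s) * Real.Gamma (2 * s))) := by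
  have hlim := (tendsto_rpow_mul_fracHeatKernel hs0 hs1 ht).const_mul 2
  have hval : 2 * (t / π * (Real.sin (π * s) * Real.Gamma (2 * s + 1))) =
      t * (4 * s / π) * Real.sin (π * s) * Real.Gamma (2 * s) := by
    rw [Real.Gamma_add_one (by positivity)]
    ring
  rw [hval] at hlim
  refine (hlim.comp (tendsto_norm_cocompact_atTop (E := ℝ))).congr fun x => ?_
  rw [deriv_explicitLayer hs0 hs1 ht, Function.comp_apply, Real.norm_eq_abs]
  have : fracHeatKernel s t |x| = fracHeatKernel s t x := by
    rcases abs_choice x with h | h <;> simp only [h, fracHeatKernel_neg]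
  rw [this]
  ring

end

/-! ### Uniqueness of layers by sliding -/

namespace IsLayerSolution
variable {s : ℝ} {f v w : ℝ → ℝ}

lemma continuous (hv : IsLayerSolution s f v) : Continuous v := hv.differentiable.continuous

lemma strictMono (hv : IsLayerSolution s f v) : StrictMono v := strictMono_of_deriv_pos hv.deriv_pos

lemma mem_Ioo (hv : IsLayerSolution s f v) (x : ℝ) : v x ∈ Ioo (-1 : ℝ) 1 :=
  hv.strictMono.mem_Ioo_of_tendsto hv.tendsto_atBot hv.tendsto_atTop x

lemma comp_add_const (hv : IsLayerSolution s f v) (b : ℝ) :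
    IsLayerSolution s f fun x => v (x + b) where
  bounded := let ⟨M, hM⟩ := hv.bounded; ⟨M, fun x => hM (x + b)⟩
  equation x := (hv.equation (x + b)).comp_add_const
  differentiable := hv.differentiable.comp (by fun_prop)
  deriv_pos x := by
    rw [deriv_comp_add_const]
    exact hv.deriv_pos _
  tendsto_atTop := hv.tendsto_atTop.comp (tendsto_atTop_add_const_right _ b tendsto_id)
  tendsto_atBot := hv.tendsto_atBot.comp (tendsto_atBot_add_const_right _ b tendsto_id)

/-- Comparison principle: two layers are ordered as soon as they are ordered wherever they are not
both close to the same end state. A negative minimum of the difference lies where `f` is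
strictly decreasing, which contradicts the sign of the fractional Laplacian there. -/
lemma le_of_ordered_off_ends (hs0 : 0 < s) (hs1 : s < 1) (hv : IsLayerSolution s f v)
    (hw : IsLayerSolution s f w) {c : ℝ} (htop : StrictAntiOn f (Icc c 1))
    (hbot : StrictAntiOn f (Icc (-1) (-c)))
    (h : ∀ x, v x < w x → (c ≤ v x ∨ w x ≤ -c)) (x : ℝ) : w x ≤ v x := by
  by_contra! hx
  have hDc : Continuous fun y => v y - w y := hv.continuous.sub hw.continuous
  have hlim : Tendsto (fun y => v y - w y) (cocompact ℝ) (𝓝 0) := by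
    rw [cocompact_eq_atBot_atTop, tendsto_sup]
    exact ⟨by simpa using hv.tendsto_atBot.sub hw.tendsto_atBot,
      by simpa using hv.tendsto_atTop.sub hw.tendsto_atTop⟩
  obtain ⟨x₀, hx₀⟩ := hDc.exists_forall_le' x
    ((hlim.eventually (lt_mem_nhds (by linarith : v x - w x < 0))).mono fun _ => le_of_lt)
  have hneg : v x₀ < w x₀ := by linarith [hx₀ x]
  obtain ⟨y, hy⟩ : ∃ y, v x₀ - w x₀ < v y - w y :=
    (hlim.eventually (lt_mem_nhds (by linarith : v x₀ - w x₀ < 0))).exists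
  have hL := ((hv.equation x₀).sub (hw.equation x₀)).neg_of_isMin hs0 hs1 hDc hx₀ hy
  have h1 := hv.mem_Ioo x₀
  have h2 := hw.mem_Ioo x₀
  have : f (w x₀) < f (v x₀) := by
    rcases h x₀ hneg with h3 | h3
    · exact htop ⟨h3, h1.2.le⟩ ⟨h3.trans hneg.le, h2.2.le⟩ hneg
    · exact hbot ⟨h1.1.le, hneg.le.trans h3⟩ ⟨h2.1.le, h3⟩ hneg
  linarith

/-- Layers are unique up to translation if the nonlinearity is strictly decreasing near both end
states. The layer `v` is slid to the left until it lies above `w`, then back until it touches `w`;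
at the touching point the strong maximum principle gives equality. -/
theorem exists_eq_comp_add_const (hs0 : 0 < s) (hs1 : s < 1) (hv : IsLayerSolution s f v)
    (hw : IsLayerSolution s f w) {c : ℝ} (hc : c < 1) (htop : StrictAntiOn f (Icc c 1))
    (hbot : StrictAntiOn f (Icc (-1) (-c))) : ∃ b, ∀ x, w x = v (x + b) := by
  have hcomp : ∀ b, (∀ x, v (x + b) < w x → (c ≤ v (x + b) ∨ w x ≤ -c)) →
      ∀ x, w x ≤ v (x + b) := fun b =>
    (hv.comp_add_const b).le_of_ordered_off_ends hs0 hs1 hw htop hbot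
  obtain ⟨K₁, hK₁⟩ := eventually_atBot.1 (hw.tendsto_atBot.eventually
    (gt_mem_nhds (by linarith : (-1 : ℝ) < -c)))
  let B : Set ℝ := {b | ∀ x, w x ≤ v (x + b)}
  have hup : ∀ b ∈ B, ∀ b', b ≤ b' → b' ∈ B := fun b hb b' hbb x =>
    (hb x).trans (hv.strictMono.monotone (by linarith))
  have hne : B.Nonempty := by
    obtain ⟨K₂, hK₂⟩ := eventually_atTop.1 (hw.tendsto_atTop.eventually (lt_mem_nhds hc))
    obtain ⟨M, hM⟩ := eventually_atTop.1 (hv.tendsto_atTop.eventually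
      (lt_mem_nhds (max_lt hc (hw.mem_Ioo K₂).2)))
    refine ⟨M - K₁, hcomp _ fun x hx => ?_⟩
    rcases le_total x K₁ with h | h
    · exact Or.inr (hK₁ x h).le
    · exact Or.inl ((le_max_left _ _).trans (hM _ (by linarith)).le)
  have hbdd : BddBelow B := by
    obtain ⟨M, hM⟩ := eventually_atBot.1 (hv.tendsto_atBot.eventually
      (gt_mem_nhds (hw.mem_Ioo 0).1))
    refine ⟨M, fun b hb => ?_⟩
    by_contra! hlt
    have h1 := hb 0
    rw [zero_add] at h1
    exact absurd (hM b hlt.le) (not_lt.2 h1)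
  set b₀ := sInf B with hb₀
  have hmem : b₀ ∈ B := by
    intro x
    have h1 : Tendsto (fun b => v (x + b)) (𝓝[>] b₀) (𝓝 (v (x + b₀))) :=
      ((hv.continuous.comp (by fun_prop : Continuous fun b => x + b)).tendsto b₀).mono_left
        nhdsWithin_le_nhds
    refine ge_of_tendsto h1 ?_
    filter_upwards [self_mem_nhdsWithin] with b hb
    obtain ⟨b', hb', hlt⟩ := exists_lt_of_csInf_lt hne hb
    exact hup b' hb' b hlt.le x
  refine ⟨b₀, ?_⟩
  have hv₀ := hv.comp_add_const b₀
  have htouch : ∃ x₀, v (x₀ + b₀) = w x₀ := by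
    by_contra! hcon
    have hpos : ∀ x, w x < v (x + b₀) := fun x => lt_of_le_of_ne (hmem x) (hcon x).symm
    obtain ⟨K₂, hK₂⟩ := eventually_atTop.1 ((hv.comp_add_const (b₀ - 1)).tendsto_atTop.eventually
      (lt_mem_nhds hc))
    have hev : ∀ᶠ b in 𝓝 b₀, ∀ x ∈ Icc K₁ K₂, w x < v (x + b) := by
      refine isCompact_Icc.eventually_forall_of_forall_eventually fun x _ => ?_
      have hopen : IsOpen {z : ℝ × ℝ | w z.2 < v (z.2 + z.1)} :=
        isOpen_lt (hw.continuous.comp continuous_snd) (hv.continuous.comp (by fun_prop))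
      exact hopen.mem_nhds (hpos x)
    obtain ⟨b, ⟨hb1, hb2⟩, hb3⟩ : ∃ b, (b ∈ Ioo (b₀ - 1) b₀) ∧
        ∀ x ∈ Icc K₁ K₂, w x < v (x + b) := by
      have h1 : ∀ᶠ b in 𝓝[<] b₀, b ∈ Ioo (b₀ - 1) b₀ := Ioo_mem_nhdsLT (by linarith)
      exact (h1.and (hev.filter_mono nhdsWithin_le_nhds)).exists
    have : b ∈ B := hcomp b fun x hx => by
      rcases le_total x K₁ with h | h
      · exact Or.inr (hK₁ x h).le
      rcases le_total x K₂ with h' | h'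
      · exact absurd hx (not_lt.2 (hb3 x ⟨h, h'⟩).le)
      · exact Or.inl ((hK₂ x h').le.trans (hv.strictMono.monotone (by linarith)))
    exact absurd (csInf_le hbdd this) (not_le.2 hb2)
  obtain ⟨x₀, hx₀⟩ := htouch
  intro y
  by_contra hy
  have hL := ((hv₀.equation x₀).sub (hw.equation x₀)).neg_of_isMin hs0 hs1
    (hv₀.continuous.sub hw.continuous)
    (fun z => by linarith [hmem z])
    (show v (x₀ + b₀) - w x₀ < v (y + b₀) - w y by
      linarith [lt_of_le_of_ne (hmem y) hy])
  rw [hx₀, sub_self] at hL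
  exact lt_irrefl _ hL

end IsLayerSolution

/-! ### The nonlinearity -/

section
variable {s t : ℝ}

/-- The inverse of the explicit layer, defined by choice outside `(-1, 1)`. -/
noncomputable def layerInv (s t : ℝ) : ℝ → ℝ := Function.invFun (explicitLayer s t)

lemma layerInv_explicitLayer (hs0 : 0 < s) (hs1 : s < 1) (ht : 0 < t) (x : ℝ) :
    layerInv s t (explicitLayer s t x) = x :=
  Function.leftInverse_invFun (strictMono_explicitLayer hs0 hs1 ht).injective x

lemma exists_explicitLayer_eq (hs0 : 0 < s) (hs1 : s < 1) (ht : 0 < t) {u : ℝ}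
    (hu : u ∈ Ioo (-1 : ℝ) 1) : ∃ x, explicitLayer s t x = u := by
  have h1 := ((tendsto_explicitLayer_atBot hs0 hs1 ht).eventually (gt_mem_nhds hu.1)).exists
  have h2 := ((tendsto_explicitLayer_atTop hs0 hs1 ht).eventually (lt_mem_nhds hu.2)).exists
  obtain ⟨a, ha⟩ := h1
  obtain ⟨b, hb⟩ := h2
  exact mem_range_of_exists_le_of_exists_ge (continuous_explicitLayer hs0 hs1 ht) ⟨a, ha.le⟩
    ⟨b, hb.le⟩

lemma explicitLayer_layerInv (hs0 : 0 < s) (hs1 : s < 1) (ht : 0 < t) {u : ℝ}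
    (hu : u ∈ Ioo (-1 : ℝ) 1) : explicitLayer s t (layerInv s t u) = u :=
  Function.invFun_eq (exists_explicitLayer_eq hs0 hs1 ht hu)

lemma layerInv_neg (hs0 : 0 < s) (hs1 : s < 1) (ht : 0 < t) {u : ℝ} (hu : u ∈ Ioo (-1 : ℝ) 1) :
    layerInv s t (-u) = -layerInv s t u := by
  obtain ⟨x, rfl⟩ := exists_explicitLayer_eq hs0 hs1 ht hu
  rw [← explicitLayer_neg hs0 hs1 ht, layerInv_explicitLayer hs0 hs1 ht,
    layerInv_explicitLayer hs0 hs1 ht]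

lemma strictMonoOn_layerInv (hs0 : 0 < s) (hs1 : s < 1) (ht : 0 < t) :
    StrictMonoOn (layerInv s t) (Ioo (-1) 1) := by
  intro u hu u' hu' h
  rw [← (strictMono_explicitLayer hs0 hs1 ht).lt_iff_lt, explicitLayer_layerInv hs0 hs1 ht hu,
    explicitLayer_layerInv hs0 hs1 ht hu']
  exact h

lemma tendsto_layerInv_one (hs0 : 0 < s) (hs1 : s < 1) (ht : 0 < t) :
    Tendsto (layerInv s t) (𝓝[<] 1) atTop := by
  refine tendsto_atTop.2 fun M => ?_
  have hM := explicitLayer_mem_Ioo hs0 hs1 ht M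
  filter_upwards [Ioo_mem_nhdsLT hM.2] with u hu
  have hu' : u ∈ Ioo (-1 : ℝ) 1 := ⟨hM.1.trans hu.1, hu.2⟩
  have := strictMonoOn_layerInv hs0 hs1 ht hM hu' hu.1
  rw [layerInv_explicitLayer hs0 hs1 ht] at this
  exact this.le

lemma hasDerivAt_layerInv (hs0 : 0 < s) (hs1 : s < 1) (ht : 0 < t) {u : ℝ}
    (hu : u ∈ Ioo (-1 : ℝ) 1) :
    HasDerivAt (layerInv s t) (2 * fracHeatKernel s t (layerInv s t u))⁻¹ u := by
  have himg : layerInv s t '' Ioo (-1) 1 = univ :=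
    eq_univ_of_forall fun x => ⟨_, explicitLayer_mem_Ioo hs0 hs1 ht x,
      layerInv_explicitLayer hs0 hs1 ht x⟩
  have hcont : ContinuousAt (layerInv s t) u :=
    (strictMonoOn_layerInv hs0 hs1 ht).continuousAt_of_image_mem_nhds
      (Ioo_mem_nhds hu.1 hu.2) (by rw [himg]; exact univ_mem)
  refine HasDerivAt.of_local_left_inverse hcont
    (hasDerivAt_explicitLayer hs0 hs1 ht _) (mul_pos two_pos (fracHeatKernel_pos hs0 hs1 ht _)).ne' ?_
  filter_upwards [Ioo_mem_nhds hu.1 hu.2] with u' hu'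
  exact explicitLayer_layerInv hs0 hs1 ht hu'

open scoped Classical in
/-- The nonlinearity of the explicit layer, `v x ↦ x v'(x) / (2 s t)`, set to `0` outside
`(-1, 1)`. -/
noncomputable def layerNonlinearity (s t u : ℝ) : ℝ :=
  if u ∈ Ioo (-1 : ℝ) 1 then layerInv s t u * fracHeatKernel s t (layerInv s t u) / (s * t) else 0

open scoped Classical in
/-- The derivative of the nonlinearity on `[-1, 1]`: the quotient of the flux and the kernel, with
its limit `-1 / t` at the end points. -/
noncomputable def layerNonlinearityDeriv (s t u : ℝ) : ℝ :=
  if u ∈ Ioo (-1 : ℝ) 1 then fracHeatFlux s t (layerInv s t u) / fracHeatKernel s t (layerInv s t u)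
  else -(1 / t)

lemma layerNonlinearity_of_mem {u : ℝ} (hu : u ∈ Ioo (-1 : ℝ) 1) : layerNonlinearity s t u =
    layerInv s t u * fracHeatKernel s t (layerInv s t u) / (s * t) := by
  rw [layerNonlinearity, if_pos hu]

lemma layerNonlinearityDeriv_of_mem {u : ℝ} (hu : u ∈ Ioo (-1 : ℝ) 1) :
    layerNonlinearityDeriv s t u =
      fracHeatFlux s t (layerInv s t u) / fracHeatKernel s t (layerInv s t u) := by
  rw [layerNonlinearityDeriv, if_pos hu]

lemma layerNonlinearity_one (s t : ℝ) : layerNonlinearity s t 1 = 0 := by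
  simp [layerNonlinearity]

lemma layerNonlinearityDeriv_one (s t : ℝ) : layerNonlinearityDeriv s t 1 = -(1 / t) := by
  simp [layerNonlinearityDeriv]

lemma neg_mem_Ioo_neg_one_one {u : ℝ} : -u ∈ Ioo (-1 : ℝ) 1 ↔ u ∈ Ioo (-1 : ℝ) 1 := by
  simp only [mem_Ioo]
  constructor <;> rintro ⟨h1, h2⟩ <;> constructor <;> linarith

lemma layerNonlinearity_neg (hs0 : 0 < s) (hs1 : s < 1) (ht : 0 < t) (u : ℝ) :
    layerNonlinearity s t (-u) = -layerNonlinearity s t u := by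
  by_cases hu : u ∈ Ioo (-1 : ℝ) 1
  · rw [layerNonlinearity_of_mem hu, layerNonlinearity_of_mem (neg_mem_Ioo_neg_one_one.2 hu),
      layerInv_neg hs0 hs1 ht hu, fracHeatKernel_neg]
    ring
  · rw [layerNonlinearity, layerNonlinearity, if_neg hu,
      if_neg (mt neg_mem_Ioo_neg_one_one.1 hu), neg_zero]

lemma layerNonlinearityDeriv_neg (hs0 : 0 < s) (hs1 : s < 1) (ht : 0 < t) (u : ℝ) :
    layerNonlinearityDeriv s t (-u) = layerNonlinearityDeriv s t u := by
  by_cases hu : u ∈ Ioo (-1 : ℝ) 1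
  · rw [layerNonlinearityDeriv_of_mem hu,
      layerNonlinearityDeriv_of_mem (neg_mem_Ioo_neg_one_one.2 hu),
      layerInv_neg hs0 hs1 ht hu, fracHeatKernel_neg, fracHeatFlux_neg]
  · rw [layerNonlinearityDeriv, layerNonlinearityDeriv, if_neg hu,
      if_neg (mt neg_mem_Ioo_neg_one_one.1 hu)]

lemma layerNonlinearity_pos (hs0 : 0 < s) (hs1 : s < 1) (ht : 0 < t) {u : ℝ}
    (hu : u ∈ Ioo (0 : ℝ) 1) : 0 < layerNonlinearity s t u := by
  have hu' : u ∈ Ioo (-1 : ℝ) 1 := ⟨by linarith [hu.1], hu.2⟩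
  rw [layerNonlinearity_of_mem hu']
  have h0 : explicitLayer s t 0 = 0 := by
    rw [explicitLayer_eq_primitive hs0 hs1 ht, fracHeatPrimitive_zero, mul_zero]
  have hpos : 0 < layerInv s t u := by
    rw [← (strictMono_explicitLayer hs0 hs1 ht).lt_iff_lt, explicitLayer_layerInv hs0 hs1 ht hu', h0]
    exact hu.1
  have := fracHeatKernel_pos hs0 hs1 ht (layerInv s t u)
  positivity

lemma isLayerSolution_explicitLayer (hs0 : 0 < s) (hs1 : s < 1) (ht : 0 < t) :
    IsLayerSolution s (layerNonlinearity s t) (explicitLayer s t) where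
  bounded := ⟨1, fun x => abs_le.2 ⟨(explicitLayer_mem_Ioo hs0 hs1 ht x).1.le,
      (explicitLayer_mem_Ioo hs0 hs1 ht x).2.le⟩⟩
  equation x := by
    rw [layerNonlinearity_of_mem (explicitLayer_mem_Ioo hs0 hs1 ht x),
      layerInv_explicitLayer hs0 hs1 ht]
    exact hasFracLap_explicitLayer hs0 hs1 ht x
  differentiable x := (hasDerivAt_explicitLayer hs0 hs1 ht x).differentiableAt
  deriv_pos x := by
    rw [deriv_explicitLayer hs0 hs1 ht]
    exact mul_pos two_pos (fracHeatKernel_pos hs0 hs1 ht x)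
  tendsto_atTop := tendsto_explicitLayer_atTop hs0 hs1 ht
  tendsto_atBot := tendsto_explicitLayer_atBot hs0 hs1 ht

lemma differentiable_fracHeatFlux (hs0 : 0 < s) (ht : 0 < t) :
    Differentiable ℝ (fracHeatFlux s t) := by
  have h : fracHeatFlux s t =
      fun x => (2 * s * t)⁻¹ * deriv (fun x => x * fracHeatKernel s t x) x := by
    funext x
    rw [(hasDerivAt_mul_fracHeatKernel hs0 ht x).deriv]
    field_simp
  have hc : ContDiff ℝ ∞ fun x => x * fracHeatKernel s t x :=
    contDiff_id.mul (contDiff_fracHeatKernel hs0 ht)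
  rw [h]
  exact ((contDiff_infty_iff_deriv.1 hc).2.differentiable (by simp)).const_mul _

lemma hasDerivAt_layerNonlinearity (hs0 : 0 < s) (hs1 : s < 1) (ht : 0 < t) {u : ℝ}
    (hu : u ∈ Ioo (-1 : ℝ) 1) :
    HasDerivAt (layerNonlinearity s t) (layerNonlinearityDeriv s t u) u := by
  have hp := (fracHeatKernel_pos hs0 hs1 ht (layerInv s t u)).ne'
  have h := ((hasDerivAt_mul_fracHeatKernel hs0 ht (layerInv s t u)).comp u
    (hasDerivAt_layerInv hs0 hs1 ht hu)).div_const (s * t)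
  have hval : 2 * s * t * fracHeatFlux s t (layerInv s t u) *
      (2 * fracHeatKernel s t (layerInv s t u))⁻¹ / (s * t) = layerNonlinearityDeriv s t u := by
    rw [layerNonlinearityDeriv_of_mem hu]
    field_simp
  rw [hval] at h
  refine h.congr_of_eventuallyEq ?_
  filter_upwards [Ioo_mem_nhds hu.1 hu.2] with u' hu'
  exact layerNonlinearity_of_mem hu'

lemma differentiableAt_layerNonlinearityDeriv (hs0 : 0 < s) (hs1 : s < 1) (ht : 0 < t) {u : ℝ}
    (hu : u ∈ Ioo (-1 : ℝ) 1) : DifferentiableAt ℝ (layerNonlinearityDeriv s t) u := by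
  have hinv := (hasDerivAt_layerInv hs0 hs1 ht hu).differentiableAt
  have hk : Differentiable ℝ (fracHeatKernel s t) :=
    (contDiff_fracHeatKernel hs0 ht).differentiable (by simp)
  have h := (((differentiable_fracHeatFlux hs0 ht) _).comp u hinv).div ((hk _).comp u hinv)
    (fracHeatKernel_pos hs0 hs1 ht (layerInv s t u)).ne'
  refine h.congr_of_eventuallyEq ?_
  filter_upwards [Ioo_mem_nhds hu.1 hu.2] with u' hu'
  exact layerNonlinearityDeriv_of_mem hu'

/-! ### One-sided derivatives at the end states -/

/-- A one-sided derivative at `1` may be computed along the layer, as `x → +∞`. -/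
lemma hasDerivWithinAt_one_of_tendsto {g : ℝ → ℝ} {g' : ℝ} (hs0 : 0 < s) (hs1 : s < 1)
    (ht : 0 < t)
    (h : Tendsto (fun x => (g (explicitLayer s t x) - g 1) / (explicitLayer s t x - 1)) atTop
      (𝓝 g')) : HasDerivWithinAt g g' (Icc (-1) 1) 1 := by
  rw [hasDerivWithinAt_iff_tendsto_slope]
  have hset : Icc (-1 : ℝ) 1 \ {1} = Ico (-1) 1 := by
    ext u
    simp only [Set.mem_sdiff, mem_Icc, mem_singleton_iff, mem_Ico]
    exact ⟨fun h => ⟨h.1.1, lt_of_le_of_ne h.1.2 h.2⟩, fun h => ⟨⟨h.1, h.2.le⟩, h.2.ne⟩⟩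
  rw [hset, nhdsWithin_Ico_eq_nhdsLT (by norm_num)]
  refine (h.comp (tendsto_layerInv_one hs0 hs1 ht)).congr' ?_
  filter_upwards [Ioo_mem_nhdsLT (by norm_num : (-1 : ℝ) < 1)] with u hu
  rw [Function.comp_apply, explicitLayer_layerInv hs0 hs1 ht hu, slope_def_field]

lemma hasDerivWithinAt_layerNonlinearity_one (hs0 : 0 < s) (hs1 : s < 1) (ht : 0 < t) :
    HasDerivWithinAt (layerNonlinearity s t) (-(1 / t)) (Icc (-1) 1) 1 := by
  refine hasDerivWithinAt_one_of_tendsto hs0 hs1 ht ?_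
  have hS := sin_pi_mul_pos hs0 hs1
  have hG := Real.Gamma_pos_of_pos (by positivity : 0 < 2 * s)
  have h1 := tendsto_rpow_mul_fracHeatKernel hs0 hs1 ht
  have h2 := tendsto_rpow_mul_one_sub_explicitLayer hs0 hs1 ht
  have h := (h1.div h2 (by positivity)).const_mul (-(1 / (s * t)))
  have hval : -(1 / (s * t)) * (t / π * (Real.sin (π * s) * Real.Gamma (2 * s + 1)) /
      (t * (2 / π) * Real.sin (π * s) * Real.Gamma (2 * s))) = -(1 / t) := by
    rw [Real.Gamma_add_one (by positivity)]
    have hS' : Real.sin (s * π) ≠ 0 := by rw [mul_comm]; exact hS.ne'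
    field_simp
  rw [hval] at h
  refine h.congr' ?_
  filter_upwards [eventually_gt_atTop 0] with x hx
  have hv := explicitLayer_mem_Ioo hs0 hs1 ht x
  have hv1 : 1 - explicitLayer s t x ≠ 0 := by linarith [hv.2]
  have hy := (Real.rpow_pos_of_pos hx (2 * s)).ne'
  rw [layerNonlinearity_one, layerNonlinearity_of_mem hv, layerInv_explicitLayer hs0 hs1 ht,
    show explicitLayer s t x - 1 = -(1 - explicitLayer s t x) by ring, Pi.div_apply,
    Real.rpow_add hx, Real.rpow_one]
  field_simp
  ring

/-- Along the layer the difference quotient of the derivative is `(p + t q) / (t p (v - 1))`, a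
quotient of quantities with known leading behaviour at infinity. -/
lemma hasDerivWithinAt_layerNonlinearityDeriv_one (hs0 : 0 < s) (hs1 : s < 1) (ht : 0 < t) :
    HasDerivWithinAt (layerNonlinearityDeriv s t)
      (-(π / t) * (Real.cos (π * s) / Real.sin (π * s)) *
        (Real.Gamma (4 * s) / Real.Gamma (2 * s) ^ 2)) (Icc (-1) 1) 1 := by
  refine hasDerivWithinAt_one_of_tendsto hs0 hs1 ht ?_
  have hS := sin_pi_mul_pos hs0 hs1
  have hG := Real.Gamma_pos_of_pos (by positivity : 0 < 2 * s)
  have hG' := Real.Gamma_pos_of_pos (by positivity : 0 < 2 * s + 1)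
  have h1 := tendsto_rpow_mul_fracHeatKernel hs0 hs1 ht
  have h2 := tendsto_rpow_mul_one_sub_explicitLayer hs0 hs1 ht
  have h3 := tendsto_rpow_mul_fracHeatKernel_add_flux hs0 hs1 ht
  have h := (h3.div (h1.mul h2) (by positivity)).const_mul (-(1 / t))
  have hval : -(1 / t) * (t ^ 2 / π * (Real.sin (2 * π * s) * Real.Gamma (4 * s + 1) / 2) /
      (t / π * (Real.sin (π * s) * Real.Gamma (2 * s + 1)) *
        (t * (2 / π) * Real.sin (π * s) * Real.Gamma (2 * s)))) =
      -(π / t) * (Real.cos (π * s) / Real.sin (π * s)) *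
        (Real.Gamma (4 * s) / Real.Gamma (2 * s) ^ 2) := by
    rw [Real.Gamma_add_one (by positivity), Real.Gamma_add_one (by positivity),
      show 2 * π * s = 2 * (π * s) by ring, Real.sin_two_mul]
    field_simp
    ring
  rw [hval] at h
  refine h.congr' ?_
  filter_upwards [eventually_gt_atTop 0] with x hx
  have hv := explicitLayer_mem_Ioo hs0 hs1 ht x
  have hv1 : 1 - explicitLayer s t x ≠ 0 := by linarith [hv.2]
  have hy := (Real.rpow_pos_of_pos hx (2 * s)).ne'
  have hp := (fracHeatKernel_pos hs0 hs1 ht x).ne'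
  rw [layerNonlinearityDeriv_one, layerNonlinearityDeriv_of_mem hv,
    layerInv_explicitLayer hs0 hs1 ht, Pi.div_apply,
    show 1 + 4 * s = 1 + 2 * s + 2 * s by ring, Real.rpow_add hx (1 + 2 * s), Real.rpow_add hx,
    Real.rpow_one, show explicitLayer s t x - 1 = -(1 - explicitLayer s t x) by ring]
  field_simp
  ring

lemma HasDerivWithinAt.neg_Icc_neg_one_one {g : ℝ → ℝ} {g' : ℝ}
    (h : HasDerivWithinAt g g' (Icc (-1) 1) 1) :
    HasDerivWithinAt (fun u => g (-u)) (-g') (Icc (-1) 1) (-1) := by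
  have h1 : HasDerivWithinAt (fun u : ℝ => -u) (-1) (Icc (-1) 1) (-1) :=
    (hasDerivAt_neg (-1 : ℝ)).hasDerivWithinAt
  have h2 : HasDerivWithinAt g g' (Icc (-1) 1) (-(-1)) := by rwa [neg_neg]
  have h3 := h2.scomp (-1 : ℝ) h1 fun u hu => ⟨neg_le_neg hu.2, by linarith [hu.1]⟩
  simpa [Function.comp_def] using h3

lemma hasDerivWithinAt_layerNonlinearity (hs0 : 0 < s) (hs1 : s < 1) (ht : 0 < t) {u : ℝ}
    (hu : u ∈ Icc (-1 : ℝ) 1) :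
    HasDerivWithinAt (layerNonlinearity s t) (layerNonlinearityDeriv s t u) (Icc (-1) 1) u := by
  rcases eq_endpoints_or_mem_Ioo_of_mem_Icc hu with rfl | rfl | h
  · have h := (hasDerivWithinAt_layerNonlinearity_one hs0 hs1 ht).neg_Icc_neg_one_one.fun_neg
    simp only [layerNonlinearity_neg hs0 hs1 ht, neg_neg] at h
    rwa [layerNonlinearityDeriv_neg hs0 hs1 ht, layerNonlinearityDeriv_one]
  · rw [layerNonlinearityDeriv_one]
    exact hasDerivWithinAt_layerNonlinearity_one hs0 hs1 ht
  · exact (hasDerivAt_layerNonlinearity hs0 hs1 ht h).hasDerivWithinAt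

lemma differentiableOn_layerNonlinearityDeriv (hs0 : 0 < s) (hs1 : s < 1) (ht : 0 < t) :
    DifferentiableOn ℝ (layerNonlinearityDeriv s t) (Icc (-1) 1) := by
  intro u hu
  rcases eq_endpoints_or_mem_Ioo_of_mem_Icc hu with rfl | rfl | h
  · have h := (hasDerivWithinAt_layerNonlinearityDeriv_one hs0 hs1 ht).neg_Icc_neg_one_one
    simp only [layerNonlinearityDeriv_neg hs0 hs1 ht] at h
    exact h.differentiableWithinAt
  · exact (hasDerivWithinAt_layerNonlinearityDeriv_one hs0 hs1 ht).differentiableWithinAt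
  · exact (differentiableAt_layerNonlinearityDeriv hs0 hs1 ht h).differentiableWithinAt

lemma derivWithin_layerNonlinearity (hs0 : 0 < s) (hs1 : s < 1) (ht : 0 < t) {u : ℝ}
    (hu : u ∈ Icc (-1 : ℝ) 1) :
    derivWithin (layerNonlinearity s t) (Icc (-1) 1) u = layerNonlinearityDeriv s t u :=
  (hasDerivWithinAt_layerNonlinearity hs0 hs1 ht hu).derivWithin
    (uniqueDiffOn_Icc (by norm_num) u hu)

lemma contDiffOn_layerNonlinearity (hs0 : 0 < s) (hs1 : s < 1) (ht : 0 < t) :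
    ContDiffOn ℝ 1 (layerNonlinearity s t) (Icc (-1) 1) := by
  rw [contDiffOn_one_iff_derivWithin (uniqueDiffOn_Icc (by norm_num))]
  refine ⟨fun u hu => (hasDerivWithinAt_layerNonlinearity hs0 hs1 ht hu).differentiableWithinAt, ?_⟩
  exact (differentiableOn_layerNonlinearityDeriv hs0 hs1 ht).continuousOn.congr
    fun u hu => derivWithin_layerNonlinearity hs0 hs1 ht hu

lemma exists_strictAntiOn_layerNonlinearity (hs0 : 0 < s) (hs1 : s < 1) (ht : 0 < t) :
    ∃ c < 1, StrictAntiOn (layerNonlinearity s t) (Icc c 1) ∧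
      StrictAntiOn (layerNonlinearity s t) (Icc (-1) (-c)) := by
  have hcont := (differentiableOn_layerNonlinearityDeriv hs0 hs1 ht).continuousOn 1 (by simp)
  have hev : ∀ᶠ u in 𝓝[Icc (-1) 1] 1, layerNonlinearityDeriv s t u < 0 := by
    refine hcont.eventually (gt_mem_nhds ?_)
    rw [layerNonlinearityDeriv_one]
    simpa using ht
  rw [nhdsWithin_Icc_eq_nhdsLE (by norm_num)] at hev
  obtain ⟨c₀, hc₀, hc⟩ := mem_nhdsLE_iff_exists_Ioc_subset.1 hev
  set c := max c₀ 0 with hcdef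
  have hc1 : c < 1 := max_lt hc₀ one_pos
  have hsub : Icc c 1 ⊆ Icc (-1 : ℝ) 1 :=
    Icc_subset_Icc_left (by linarith [le_max_right c₀ (0 : ℝ)])
  have htop : StrictAntiOn (layerNonlinearity s t) (Icc c 1) := by
    refine strictAntiOn_of_deriv_neg (convex_Icc _ _)
      ((contDiffOn_layerNonlinearity hs0 hs1 ht).continuousOn.mono hsub) fun u hu => ?_
    rw [interior_Icc] at hu
    have hu' : u ∈ Ioo (-1 : ℝ) 1 := ⟨by linarith [hu.1, le_max_right c₀ (0 : ℝ)], hu.2⟩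
    rw [(hasDerivAt_layerNonlinearity hs0 hs1 ht hu').deriv]
    exact hc ⟨(le_max_left _ _).trans_lt hu.1, hu.2.le⟩
  refine ⟨c, hc1, htop, fun u hu u' hu' h => ?_⟩
  have := htop (a := -u') (b := -u) ⟨by linarith [hu'.2], by linarith [hu'.1]⟩
    ⟨by linarith [hu.2], by linarith [hu.1]⟩ (by linarith)
  rw [layerNonlinearity_neg hs0 hs1 ht, layerNonlinearity_neg hs0 hs1 ht] at this
  linarith

end

/-! ### Properties of the explicit layer -/

theorem theorem3p1 (s : ℝ) (hs0 : 0 < s) (hs1 : s < 1) :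
    -- the kernel in the definition of the explicit layer is a fundamental solution
    IsFundamentalSolution s (fracHeatKernel s) ∧
    ∀ t : ℝ, 0 < t →
      ContDiff ℝ ∞ (explicitLayer s t) ∧
      -- the other expressions of the explicit layer
      (∀ x : ℝ, explicitLayer s t x = 2 * ∫ y in (0 : ℝ)..x, fracHeatKernel s t y) ∧
      (∀ x : ℝ,
        IntegrableOn (fun r : ℝ => Real.sin (x * r) / r * Real.exp (-(t * r ^ (2 * s))))
          (Ioi 0) ∧
        explicitLayer s t x =
          2 / π * ∫ r in Ioi (0 : ℝ), Real.sin (x * r) / r * Real.exp (-(t * r ^ (2 * s)))) ∧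
      (∀ x : ℝ, x ≠ 0 →
        IntegrableOn (fun z : ℝ => Real.sin z / z * Real.exp (-(t * (z / |x|) ^ (2 * s))))
          (Ioi 0) ∧
        explicitLayer s t x =
          Real.sign x * (2 / π *
            ∫ z in Ioi (0 : ℝ), Real.sin z / z * Real.exp (-(t * (z / |x|) ^ (2 * s))))) ∧
      -- it is the layer solution, unique up to translations, for some nonlinearity
      (∃ f : ℝ → ℝ,
        IsLayerSolution s f (explicitLayer s t) ∧
        (∀ w : ℝ → ℝ, IsLayerSolution s f w →
          ∃ b : ℝ, ∀ x : ℝ, w x = explicitLayer s t (x + b)) ∧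
        ContDiffOn ℝ 1 f (Icc (-1) 1) ∧
        (∀ u ∈ Icc (-1 : ℝ) 1, f (-u) = -f u) ∧
        DifferentiableOn ℝ (derivWithin f (Icc (-1) 1)) (Icc (-1) 1) ∧
        f 0 = 0 ∧ f 1 = 0 ∧
        (∀ u ∈ Ioo (0 : ℝ) 1, 0 < f u) ∧
        derivWithin f (Icc (-1) 1) 1 = -(1 / t) ∧
        derivWithin f (Icc (-1) 1) (-1) = -(1 / t) ∧
        derivWithin (derivWithin f (Icc (-1) 1)) (Icc (-1) 1) 1 =
          -(π / t) * (Real.cos (π * s) / Real.sin (π * s)) *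
            (Real.Gamma (4 * s) / Real.Gamma (2 * s) ^ 2) ∧
        (s < 1 / 2 → derivWithin (derivWithin f (Icc (-1) 1)) (Icc (-1) 1) 1 < 0) ∧
        (s = 1 / 2 → derivWithin (derivWithin f (Icc (-1) 1)) (Icc (-1) 1) 1 = 0) ∧
        (1 / 2 < s → 0 < derivWithin (derivWithin f (Icc (-1) 1)) (Icc (-1) 1) 1)) ∧
      -- the asymptotic behaviour at infinity
      Tendsto (fun x : ℝ => |x| ^ (1 + 2 * s) * deriv (explicitLayer s t) x) (cocompact ℝ)
        (𝓝 (t * (4 * s / π) * Real.sin (π * s) * Real.Gamma (2 * s))) ∧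
      0 < t * (4 * s / π) * Real.sin (π * s) * Real.Gamma (2 * s) ∧
      Tendsto (fun x : ℝ => |x| ^ (2 * s) * |explicitLayer s t x - 1|) atTop
        (𝓝 (t * (2 / π) * Real.sin (π * s) * Real.Gamma (2 * s))) ∧
      Tendsto (fun x : ℝ => |x| ^ (2 * s) * |explicitLayer s t x + 1|) atBot
        (𝓝 (t * (2 / π) * Real.sin (π * s) * Real.Gamma (2 * s))) ∧
      0 < t * (2 / π) * Real.sin (π * s) * Real.Gamma (2 * s) := by
  refine ⟨isFundamentalSolution_fracHeatKernel hs0 hs1, fun t ht => ?_⟩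
  have hS := sin_pi_mul_pos hs0 hs1
  have hG2 := Real.Gamma_pos_of_pos (by positivity : 0 < 2 * s)
  have hG4 := Real.Gamma_pos_of_pos (by positivity : 0 < 4 * s)
  have hmem : (1 : ℝ) ∈ Icc (-1 : ℝ) 1 := by simp
  have hmem' : (-1 : ℝ) ∈ Icc (-1 : ℝ) 1 := by simp
  have hcongr := fun u (hu : u ∈ Icc (-1 : ℝ) 1) => derivWithin_layerNonlinearity hs0 hs1 ht hu
  have hd2 : derivWithin (derivWithin (layerNonlinearity s t) (Icc (-1) 1)) (Icc (-1) 1) 1 =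
      -(π / t) * (Real.cos (π * s) / Real.sin (π * s)) *
        (Real.Gamma (4 * s) / Real.Gamma (2 * s) ^ 2) := by
    rw [derivWithin_congr hcongr (hcongr 1 hmem)]
    exact (hasDerivWithinAt_layerNonlinearityDeriv_one hs0 hs1 ht).derivWithin
      (uniqueDiffOn_Icc (by norm_num) 1 hmem)
  refine ⟨contDiff_explicitLayer hs0 hs1 ht, fun x => ?_, fun x => ?_, fun x hx => ?_,
    ⟨layerNonlinearity s t, isLayerSolution_explicitLayer hs0 hs1 ht, fun w hw => ?_,
      contDiffOn_layerNonlinearity hs0 hs1 ht, fun u _ => layerNonlinearity_neg hs0 hs1 ht u,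
      ?_, ?_, layerNonlinearity_one s t, fun u hu => layerNonlinearity_pos hs0 hs1 ht hu,
      ?_, ?_, hd2, fun h => ?_, fun h => ?_, fun h => ?_⟩,
    tendsto_rpow_mul_deriv_explicitLayer hs0 hs1 ht, by positivity,
    tendsto_rpow_mul_abs_explicitLayer_sub_one hs0 hs1 ht,
    tendsto_rpow_mul_abs_explicitLayer_add_one hs0 hs1 ht, by positivity⟩
  · rw [intervalIntegral_fracHeatKernel hs0 ht, explicitLayer_eq_primitive hs0 hs1 ht]
  · exact ⟨integrableOn_sin_div_mul_stretchedExp hs0 ht x,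
      explicitLayer_eq_sine_integral hs0 hs1 ht x⟩
  · exact ⟨integrableOn_sinc_mul_stretchedExp hs0 ht hx, explicitLayer_eq_sinc_integral hs0 hs1 ht hx⟩
  · obtain ⟨c, hc, htop, hbot⟩ := exists_strictAntiOn_layerNonlinearity hs0 hs1 ht
    exact (isLayerSolution_explicitLayer hs0 hs1 ht).exists_eq_comp_add_const hs0 hs1 hw hc htop hbot
  · exact (differentiableOn_layerNonlinearityDeriv hs0 hs1 ht).congr hcongr
  · have := layerNonlinearity_neg hs0 hs1 ht 0
    rw [neg_zero] at this
    linarith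
  · rw [hcongr 1 hmem, layerNonlinearityDeriv_one]
  · rw [hcongr (-1) hmem', layerNonlinearityDeriv_neg hs0 hs1 ht, layerNonlinearityDeriv_one]
  · have hC : 0 < Real.cos (π * s) :=
      Real.cos_pos_of_mem_Ioo ⟨by nlinarith [Real.pi_pos], by nlinarith [Real.pi_pos]⟩
    rw [hd2, neg_mul, neg_mul, neg_lt_zero]
    positivity
  · rw [hd2, h, mul_one_div, Real.cos_pi_div_two]
    simp
  · have hC : Real.cos (π * s) < 0 :=
      Real.cos_neg_of_pi_div_two_lt_of_lt (by nlinarith [Real.pi_pos]) (by nlinarith [Real.pi_pos])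
    rw [hd2]
    exact mul_pos (mul_pos_of_neg_of_neg (neg_neg_of_pos (by positivity)) (div_neg_of_neg_of_pos hC hS))
      (by positivity)
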